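/- Let $d\in\mathbb{N}$. A \emph{weight sequence} is a sequence $(M_p)_{p\in\mathbb{N}}$ of positive reals with $\lim_{p\to\infty} M_p/M_{p-1}=\infty$; consider the conditions $(M.1)$: $M_p^2\le M_{p-1}M_{p+1}$ for $p\ge 1$, and $(M.2)'$: $M_{p+1}\le C_0H^pM_p$ for all $p\in\mathbb{N}$ and some $C_0,H\ge 1$. The associated function of a weight sequence $A_p$ is $A(t)=\sup_{p\in\mathbb{N}}\log\frac{t^pA_0}{A_p}$ for $t>0$, $A(0)=0$, and $A(x)=A(|x|)$ for $x\in\mathbb{R}^d$ (Euclidean norm). Let $\mathfrak{R}$ be the set of all positive increasing sequences $(r_j)_{j\in\mathbb{N}}$ tending to infinity. For $v:\mathbb{R}^d\to(0,\infty)$, $h>0$, $(r_j)\in\mathfrak{R}$, and complex-valued $\varphi\in C^\infty(\mathbb{R}^d)$ put $$\|\varphi\|_{\mathcal{D}^{M_p,h}_{L^\infty_v}}=\sup_{\alpha\in\mathbb{N}^d}\sup_{x\in\mathbb{R}^d}\frac{h^{|\alpha|}|\partial^\alpha\varphi(x)|v(x)}{M_{|\alpha|}},\qquad \|\varphi\|_{\mathcal{D}^{M_p,r_j}_{L^\infty_v}}=\sup_{\alpha\in\mathbb{N}^d}\sup_{x\in\mathbb{R}^d}\frac{|\partial^\alpha\varphi(x)|v(x)}{M_{|\alpha|}\prod_{j=0}^{|\alpha|}r_j},$$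 and let $\mathcal{D}^{M_p,h}_{L^\infty_v}(\mathbb{R}^d)$ be the normed space of all $\varphi\in C^\infty(\mathbb{R}^d)$ for which the first norm is finite. Let $\mathcal{S}^{(M_p)}_{(A_p)}(\mathbb{R}^d)$ be the Gelfand--Shilov space of Beurling type, i.e. the space of all $\varphi\in C^\infty(\mathbb{R}^d)$ with $\|\varphi\|_{\mathcal{D}^{M_p,h}_{L^\infty_v}}<\infty$ for $v=e^{A(\tau\,\cdot\,)}$ and all $h,\tau>0$. \textbf{Theorem.} Let $M_p$ and $A_p$ be weight sequences satisfying $(M.1)$ and $(M.2)'$ such that $\mathcal{S}^{(M_p)}_{(A_p)}(\mathbb{R}^d)\ne\{0\}$, and let $\omega$ be a positive (Lebesgue) measurable function on $\mathbb{R}^d$ such that, for some $C,\tau>0$, $$\omega(x+y)\le C\omega(x)e^{A(\tau y)},\qquad x,y\in\mathbb{R}^d.$$ Let $\mathcal{D}^{\{M_p\}}_{L^\infty_\omega}(\mathbb{R}^d)=\bigcup_{h>0}\mathcal{D}^{M_p,h}_{L^\infty_\omega}(\mathbb{R}^d)$, endowed with the locally convex inductive limit topology as $h\to0^+$ (the finest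 locally convex topology for which all inclusions $\mathcal{D}^{M_p,h}_{L^\infty_\omega}(\mathbb{R}^d)\to\mathcal{D}^{\{M_p\}}_{L^\infty_\omega}(\mathbb{R}^d)$ are continuous), and let $\widetilde{\mathcal{D}}^{\{M_p\}}_{L^\infty_\omega}(\mathbb{R}^d)$ be the space of all $\varphi\in C^\infty(\mathbb{R}^d)$ with $\|\varphi\|_{\mathcal{D}^{M_p,r_j}_{L^\infty_\omega}}<\infty$ for all $(r_j)\in\mathfrak{R}$, endowed with the topology generated by the seminorms $\|\cdot\|_{\mathcal{D}^{M_p,r_j}_{L^\infty_\omega}}$, $(r_j)\in\mathfrak{R}$. Then $\mathcal{D}^{\{M_p\}}_{L^\infty_\omega}(\mathbb{R}^d)$ and $\widetilde{\mathcal{D}}^{\{M_p\}}_{L^\infty_\omega}(\mathbb{R}^d)$ coincide as sets and as topological vector spaces. -/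

import Mathlib

open scoped ContDiff ENNReal Topology
open Filter MeasureTheory

noncomputable section

/-! ### Weight sequences -/

/-- A weight sequence: a positive sequence with `M_p / M_{p-1} → ∞`. -/
def IsWeightSequence (M : ℕ → ℝ) : Prop :=
  (∀ p, 0 < M p) ∧ Tendsto (fun p => M (p + 1) / M p) atTop atTop

/-- Condition `(M.1)`: `M_p ^ 2 ≤ M_{p-1} M_{p+1}` for `p ≥ 1`. -/
def CondM1 (M : ℕ → ℝ) : Prop :=
  ∀ p, M (p + 1) ^ 2 ≤ M p * M (p + 2)

/-- Condition `(M.2)'`: `M_{p+1} ≤ C₀ H^p M_p` for all `p` and some `C₀, H ≥ 1`. -/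
def CondM2' (M : ℕ → ℝ) : Prop :=
  ∃ C₀ H : ℝ, 1 ≤ C₀ ∧ 1 ≤ H ∧ ∀ p, M (p + 1) ≤ C₀ * H ^ p * M p

/-- The associated function `M(t) = sup_p log (t^p M_0 / M_p)` for `t > 0`. For `t = 0` all the
terms vanish (as `Real.log 0 = 0`), so that `M(0) = 0`. -/
def associatedFun (M : ℕ → ℝ) (t : ℝ) : ℝ :=
  ⨆ p : ℕ, Real.log (t ^ p * M 0 / M p)

/-- Komatsu's family `ℜ` of positive increasing sequences tending to infinity. -/
def KomatsuFamily : Set (ℕ → ℝ) :=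
  {r | (∀ j, 0 < r j) ∧ Monotone r ∧ Tendsto r atTop atTop}

/-! ### Multi-index derivatives -/

/-- The partial derivative `∂_i f` of a function on `ℝ^d`. -/
def partialDeriv {d : ℕ} (i : Fin d) (f : EuclideanSpace ℝ (Fin d) → ℂ) :
    EuclideanSpace ℝ (Fin d) → ℂ :=
  fun x => fderiv ℝ f x (EuclideanSpace.single i 1)

/-- The derivative `∂^α f = ∂_0^{α_0} ⋯ ∂_{d-1}^{α_{d-1}} f` for a multi-index `α`. -/
def multiDeriv {d : ℕ} (α : Fin d → ℕ) (f : EuclideanSpace ℝ (Fin d) → ℂ) :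
    EuclideanSpace ℝ (Fin d) → ℂ :=
  (List.finRange d).foldr (fun i g => (partialDeriv i)^[α i] g) f

/-- The length `|α|` of a multi-index. -/
def multiLength {d : ℕ} (α : Fin d → ℕ) : ℕ := ∑ i, α i

section linearity

variable {d : ℕ} {f g : EuclideanSpace ℝ (Fin d) → ℂ}

theorem contDiff_partialDeriv (i : Fin d) (hf : ContDiff ℝ ∞ f) :
    ContDiff ℝ ∞ (partialDeriv i f) :=
  (hf.fderiv_right (m := ∞) (by simp)).clm_apply contDiff_const

theorem contDiff_partialDeriv_iterate (i : Fin d) (n : ℕ) (hf : ContDiff ℝ ∞ f) :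
    ContDiff ℝ ∞ ((partialDeriv i)^[n] f) := by
  induction n with
  | zero => exact hf
  | succ n ih => rw [Function.iterate_succ_apply']; exact contDiff_partialDeriv i ih

theorem partialDeriv_add (i : Fin d) (hf : ContDiff ℝ ∞ f) (hg : ContDiff ℝ ∞ g) :
    partialDeriv i (f + g) = partialDeriv i f + partialDeriv i g := by
  funext x
  simp [partialDeriv, fderiv_add (hf.differentiable (by simp) x) (hg.differentiable (by simp) x)]

theorem partialDeriv_smul (i : Fin d) (c : ℂ) (hf : ContDiff ℝ ∞ f) :
    partialDeriv i (c • f) = c • partialDeriv i f := by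
  funext x
  simp [partialDeriv, fderiv_const_smul (hf.differentiable (by simp) x)]

theorem partialDeriv_iterate_add (i : Fin d) (n : ℕ) (hf : ContDiff ℝ ∞ f)
    (hg : ContDiff ℝ ∞ g) :
    (partialDeriv i)^[n] (f + g) = (partialDeriv i)^[n] f + (partialDeriv i)^[n] g := by
  induction n with
  | zero => rfl
  | succ n ih =>
    simp only [Function.iterate_succ_apply', ih]
    exact partialDeriv_add i (contDiff_partialDeriv_iterate i n hf) (contDiff_partialDeriv_iterate i n hg)

theorem partialDeriv_iterate_smul (i : Fin d) (n : ℕ) (c : ℂ) (hf : ContDiff ℝ ∞ f) :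
    (partialDeriv i)^[n] (c • f) = c • (partialDeriv i)^[n] f := by
  induction n with
  | zero => rfl
  | succ n ih =>
    simp only [Function.iterate_succ_apply', ih]
    exact partialDeriv_smul i c (contDiff_partialDeriv_iterate i n hf)

theorem contDiff_foldr_partialDeriv (α : Fin d → ℕ) (l : List (Fin d)) (hf : ContDiff ℝ ∞ f) :
    ContDiff ℝ ∞ (l.foldr (fun i g => (partialDeriv i)^[α i] g) f) := by
  induction l with
  | nil => exact hf
  | cons i l ih => exact contDiff_partialDeriv_iterate i (α i) ih

theorem multiDeriv_add (α : Fin d → ℕ) (hf : ContDiff ℝ ∞ f) (hg : ContDiff ℝ ∞ g) :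
    multiDeriv α (f + g) = multiDeriv α f + multiDeriv α g := by
  unfold multiDeriv
  induction List.finRange d with
  | nil => rfl
  | cons i l ih =>
    simp only [List.foldr_cons, ih]
    exact partialDeriv_iterate_add i (α i) (contDiff_foldr_partialDeriv α l hf)
      (contDiff_foldr_partialDeriv α l hg)

theorem multiDeriv_smul (α : Fin d → ℕ) (c : ℂ) (hf : ContDiff ℝ ∞ f) :
    multiDeriv α (c • f) = c • multiDeriv α f := by
  unfold multiDeriv
  induction List.finRange d with
  | nil => rfl
  | cons i l ih =>
    simp only [List.foldr_cons, ih]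
    exact partialDeriv_iterate_smul i (α i) c (contDiff_foldr_partialDeriv α l hf)

end linearity

/-! ### The weighted (semi)normed spaces -/

/-- The extended-real-valued quantity `sup_α sup_x |∂^α φ(x)| v(x) / N_{|α|}`. -/
def weightedSup {d : ℕ} (N : ℕ → ℝ) (v : EuclideanSpace ℝ (Fin d) → ℝ)
    (φ : EuclideanSpace ℝ (Fin d) → ℂ) : ℝ≥0∞ :=
  ⨆ (α : Fin d → ℕ) (x : EuclideanSpace ℝ (Fin d)),
    ‖multiDeriv α φ x‖ₑ * ENNReal.ofReal (v x / N (multiLength α))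

section weightedSup

variable {d : ℕ} (N : ℕ → ℝ) (v : EuclideanSpace ℝ (Fin d) → ℝ)
  {f g : EuclideanSpace ℝ (Fin d) → ℂ}

theorem weightedSup_add_le (hf : ContDiff ℝ ∞ f) (hg : ContDiff ℝ ∞ g) :
    weightedSup N v (f + g) ≤ weightedSup N v f + weightedSup N v g := by
  refine iSup₂_le fun α x => ?_
  rw [multiDeriv_add α hf hg, Pi.add_apply]
  calc _ ≤ (‖multiDeriv α f x‖ₑ + ‖multiDeriv α g x‖ₑ) *
        ENNReal.ofReal (v x / N (multiLength α)) := by gcongr; exact enorm_add_le _ _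
    _ ≤ _ := by
      rw [add_mul]
      exact add_le_add
        (le_iSup₂ (f := fun α x => ‖multiDeriv α f x‖ₑ *
          ENNReal.ofReal (v x / N (multiLength α))) α x)
        (le_iSup₂ (f := fun α x => ‖multiDeriv α g x‖ₑ *
          ENNReal.ofReal (v x / N (multiLength α))) α x)

theorem weightedSup_smul (c : ℂ) (hf : ContDiff ℝ ∞ f) :
    weightedSup N v (c • f) = ‖c‖ₑ * weightedSup N v f := by
  simp only [weightedSup, ENNReal.mul_iSup, multiDeriv_smul _ c hf, Pi.smul_apply, enorm_smul,
    mul_assoc]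

theorem weightedSup_zero : weightedSup N v (0 : EuclideanSpace ℝ (Fin d) → ℂ) = 0 := by
  have h := weightedSup_smul N v (0 : ℂ) (f := (0 : EuclideanSpace ℝ (Fin d) → ℂ)) contDiff_const
  simpa using h

end weightedSup

/-- The vector space of all `φ ∈ C^∞(ℝ^d)` with
`sup_α sup_x |∂^α φ(x)| v(x) / N_{|α|} < ∞`. -/
def weightedSubmodule {d : ℕ} (N : ℕ → ℝ) (v : EuclideanSpace ℝ (Fin d) → ℝ) :
    Submodule ℂ (EuclideanSpace ℝ (Fin d) → ℂ) where
  carrier := {φ | ContDiff ℝ ∞ φ ∧ weightedSup N v φ < ⊤}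
  add_mem' hf hg := ⟨hf.1.add hg.1,
    (weightedSup_add_le N v hf.1 hg.1).trans_lt (ENNReal.add_lt_top.2 ⟨hf.2, hg.2⟩)⟩
  zero_mem' := ⟨contDiff_const, by rw [weightedSup_zero]; exact ENNReal.zero_lt_top⟩
  smul_mem' c f hf := ⟨hf.1.const_smul c, by
    rw [weightedSup_smul N v c hf.1]; exact ENNReal.mul_lt_top enorm_lt_top hf.2⟩

/-- The seminorm `sup_α sup_x |∂^α φ(x)| v(x) / N_{|α|}`. -/
def weightedSeminorm {d : ℕ} (N : ℕ → ℝ) (v : EuclideanSpace ℝ (Fin d) → ℝ) :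
    Seminorm ℂ (weightedSubmodule N v) :=
  Seminorm.of (fun φ => (weightedSup N v φ).toReal)
    (fun f g => by
      rw [← ENNReal.toReal_add f.2.2.ne g.2.2.ne]
      exact ENNReal.toReal_mono (ENNReal.add_lt_top.2 ⟨f.2.2, g.2.2⟩).ne
        (weightedSup_add_le N v f.2.1 g.2.1))
    (fun c f => by
      have h := weightedSup_smul N v c f.2.1
      simp only [Submodule.coe_smul]
      rw [h, ENNReal.toReal_mul, toReal_enorm])

/-- The seminormed space attached to `weightedSubmodule N v` (a type of its own, so as not to
carry the topology of pointwise convergence). -/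
def WeightedSpace {d : ℕ} (N : ℕ → ℝ) (v : EuclideanSpace ℝ (Fin d) → ℝ) : Type :=
  weightedSubmodule N v

instance {d : ℕ} (N : ℕ → ℝ) (v : EuclideanSpace ℝ (Fin d) → ℝ) :
    SeminormedAddCommGroup (WeightedSpace N v) :=
  (weightedSeminorm N v).toAddGroupSeminorm.toSeminormedAddCommGroup

/-- The sequence `M_p / h^p`. Then `weightedSubmodule (scaledSeq M h) v` is `D^{M_p,h}_{L^∞_v}`,
with the norm `sup_α sup_x h^{|α|} |∂^α φ(x)| v(x) / M_{|α|}`. -/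
def scaledSeq (M : ℕ → ℝ) (h : ℝ) : ℕ → ℝ := fun p => M p / h ^ p

/-- The sequence `M_p ∏_{j=0}^p r_j`. Then `weightedSubmodule (prodSeq M r) v` is
`D^{M_p,r_j}_{L^∞_v}`, with the norm `sup_α sup_x |∂^α φ(x)| v(x) / (M_{|α|} ∏_{j=0}^{|α|} r_j)`. -/
def prodSeq (M r : ℕ → ℝ) : ℕ → ℝ := fun p => M p * ∏ j ∈ Finset.range (p + 1), r j

/-- The Gelfand-Shilov space `S^{(M_p)}_{(A_p)}(ℝ^d)` of Beurling type: all `φ ∈ C^∞(ℝ^d)` with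
`sup_α sup_x h^{|α|} |∂^α φ(x)| e^{A(τ x)} / M_{|α|} < ∞` for all `h, τ > 0`. -/
def gelfandShilovBeurling (d : ℕ) (M A : ℕ → ℝ) :
    Submodule ℂ (EuclideanSpace ℝ (Fin d) → ℂ) :=
  ⨅ (h : {h : ℝ // 0 < h}) (τ : {τ : ℝ // 0 < τ}),
    weightedSubmodule (scaledSeq M h) (fun x => Real.exp (associatedFun A ((τ : ℝ) * ‖x‖)))

/-! ### The space `D^{{M_p}}_{L^∞_w}(ℝ^d)` -/

section Roumieu

variable {d : ℕ} (M : ℕ → ℝ) (w : EuclideanSpace ℝ (Fin d) → ℝ)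

theorem weightedSubmodule_scaledSeq_anti {h k : ℝ} (hk : 0 < k) (hkh : k ≤ h) :
    weightedSubmodule (scaledSeq M h) w ≤ weightedSubmodule (scaledSeq M k) w := by
  refine fun φ hφ => ⟨hφ.1, lt_of_le_of_lt ?_ hφ.2⟩
  refine iSup₂_mono fun α x => ?_
  refine mul_le_mul' le_rfl ?_
  have key : ∀ s : ℝ, 0 ≤ s → ENNReal.ofReal (w x / scaledSeq M s (multiLength α)) =
      ENNReal.ofReal (s ^ multiLength α) * ENNReal.ofReal (w x / M (multiLength α)) := by
    intro s hs
    rw [← ENNReal.ofReal_mul (by positivity), scaledSeq, div_div_eq_mul_div]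
    congr 1
    ring
  rw [key k hk.le, key h (hk.le.trans hkh)]
  gcongr

/-- The union of the spaces `D^{M_p,h}_{L^∞_w}(ℝ^d)`, `h > 0`. -/
def roumieuSubmodule : Submodule ℂ (EuclideanSpace ℝ (Fin d) → ℂ) where
  carrier := {φ | ∃ h : ℝ, 0 < h ∧ φ ∈ weightedSubmodule (scaledSeq M h) w}
  add_mem' := by
    rintro f g ⟨h, hh, hf⟩ ⟨k, hk, hg⟩
    have hm : 0 < min h k := lt_min hh hk
    exact ⟨min h k, hm, Submodule.add_mem _
      (weightedSubmodule_scaledSeq_anti M w hm (min_le_left _ _) hf)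
      (weightedSubmodule_scaledSeq_anti M w hm (min_le_right _ _) hg)⟩
  zero_mem' := ⟨1, one_pos, Submodule.zero_mem _⟩
  smul_mem' := by
    rintro c f ⟨h, hh, hf⟩
    exact ⟨h, hh, Submodule.smul_mem _ c hf⟩

/-- The space `D^{{M_p}}_{L^∞_w}(ℝ^d)`. -/
def RoumieuSpace : Type := roumieuSubmodule M w

instance : AddCommGroup (RoumieuSpace M w) := inferInstanceAs (AddCommGroup (roumieuSubmodule M w))

instance : Module ℂ (RoumieuSpace M w) := inferInstanceAs (Module ℂ (roumieuSubmodule M w))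

instance : Module ℝ (RoumieuSpace M w) := Module.restrictScalars ℝ ℂ (RoumieuSpace M w)

instance : CoeFun (RoumieuSpace M w) (fun _ => EuclideanSpace ℝ (Fin d) → ℂ) :=
  ⟨fun φ => Subtype.val φ⟩

/-- The inclusion of `D^{M_p,h}_{L^∞_w}(ℝ^d)` in `D^{{M_p}}_{L^∞_w}(ℝ^d)`. -/
def RoumieuSpace.ofStep (h : {h : ℝ // 0 < h}) :
    WeightedSpace (scaledSeq M h) w → RoumieuSpace M w :=
  fun φ => ⟨φ.1, h, h.2, φ.2⟩

/-- The locally convex inductive limit topology: the finest locally convex vector space topology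
for which all the inclusions of the steps `D^{M_p,h}_{L^∞_w}(ℝ^d)`, `h > 0`, are continuous. -/
instance RoumieuSpace.topologicalSpace : TopologicalSpace (RoumieuSpace M w) :=
  sInf {t | (∀ h, Continuous[inferInstance, t] (RoumieuSpace.ofStep M w h)) ∧
    @IsTopologicalAddGroup _ t _ ∧
    @ContinuousSMul ℂ _ _ _ t ∧
    @LocallyConvexSpace ℝ _ _ _ _ _ t}

end Roumieu

/-! ### The space `D̃^{{M_p}}_{L^∞_w}(ℝ^d)` -/

section RoumieuProj

variable {d : ℕ} (M : ℕ → ℝ) (w : EuclideanSpace ℝ (Fin d) → ℝ)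

/-- The intersection of the spaces `D^{M_p,r_j}_{L^∞_w}(ℝ^d)` over all `(r_j) ∈ ℜ`. -/
def roumieuProjSubmodule : Submodule ℂ (EuclideanSpace ℝ (Fin d) → ℂ) :=
  ⨅ r : KomatsuFamily, weightedSubmodule (prodSeq M r) w

/-- The space `D̃^{{M_p}}_{L^∞_w}(ℝ^d)`. -/
def RoumieuProjSpace : Type := roumieuProjSubmodule M w

instance : AddCommGroup (RoumieuProjSpace M w) :=
  inferInstanceAs (AddCommGroup (roumieuProjSubmodule M w))

instance : Module ℂ (RoumieuProjSpace M w) :=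
  inferInstanceAs (Module ℂ (roumieuProjSubmodule M w))

instance : CoeFun (RoumieuProjSpace M w) (fun _ => EuclideanSpace ℝ (Fin d) → ℂ) :=
  ⟨fun φ => Subtype.val φ⟩

/-- The seminorms `‖ · ‖_{D^{M_p,r_j}_{L^∞_w}}`, `(r_j) ∈ ℜ`, on `D̃^{{M_p}}_{L^∞_w}(ℝ^d)`. -/
def roumieuProjSeminorms : SeminormFamily ℂ (RoumieuProjSpace M w) KomatsuFamily :=
  fun r => (weightedSeminorm (prodSeq M r) w).comp
    (Submodule.inclusion (iInf_le (fun r : KomatsuFamily =>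
      weightedSubmodule (prodSeq M r) w) r))

theorem komatsuFamily_nonempty : KomatsuFamily.Nonempty :=
  ⟨fun j => (j : ℝ) + 1, fun j => by positivity, fun i j hij => by simpa using hij,
    tendsto_atTop_add_const_right _ _ tendsto_natCast_atTop_atTop⟩

instance : Nonempty KomatsuFamily := komatsuFamily_nonempty.to_subtype

/-- The topology generated by the seminorms `‖ · ‖_{D^{M_p,r_j}_{L^∞_w}}`, `(r_j) ∈ ℜ`. -/
instance RoumieuProjSpace.topologicalSpace : TopologicalSpace (RoumieuProjSpace M w) :=
  (roumieuProjSeminorms M w).moduleFilterBasis.topology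

end RoumieuProj

end

/-! One inclusion is soft: since $r_j\to\infty$, a geometric sequence is dominated by $\prod_{j\le
n} r_j$, so each step embeds continuously in each $r$-normed space. For the reverse inclusion of
sets, if $\varphi$ lies in no step, one violated estimate per $k$ is selected, and a sequence of
$\mathfrak R$ growing slowly enough to respect all the selected orders makes the corresponding norm
of $\varphi$ infinite (`exists_komatsuFamily_prod_le`, `roumieuSubmodule_eq_roumieuProjSubmodule`).

The substance is that every continuous seminorm $p$ of the inductive limit is dominated by a single
$r$-norm. A nonzero $\psi$ in the Gelfand-Shilov space serves as window for the short-time Fourier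
transform, and $\|\psi\|_2^2\,\varphi$ is recovered by synthesis (`stftSynth_stft`). Bounds on the
derivatives of $\varphi$ become decay of the transform $G$ in the frequency $\xi$
(`IsWindow.exists_stft_le`), and decay of type $1/\sup_n (h|\xi|)^n/M_n$ is carried by synthesis
back into one step of the limit (`IsWindow.exists_stftSynth`).

Unlike $\varphi$, the function $G$ can be cut. Phase space is split into frequency shells
$R_k\le|\xi|<R_{k+1}$, and on the $k$-th shell $p$ is controlled at scale $h_k\sim 1/(k+1)$ with
some constant $Q_k$. If $R_k$ is large, passing from $h_k$ to $2h_k$ gains $2^{-k}/Q_k$ there, so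
the pieces sum. Since $|\xi|$ is bounded on a shell, only finitely many orders $n$ matter there, and
a slowly increasing $r$ meets all the requirements at once (`exists_shells`,
`exists_komatsuFamily_le`). Condition $(M.1)$ makes products of derivatives compatible with $M_p$;
$(M.2)'$ supplies the polynomial decay that makes the integrals converge. -/

noncomputable section

/-! ### Growth functions of weight sequences -/

/-- The growth function `sup_n t^n / M_n`, which is `exp (M(t)) / M_0`. -/
def growth (M : ℕ → ℝ) (t : ℝ) : ℝ := ⨆ n : ℕ, t ^ n / M n

/-- Ratio test: $|t|M_n/M_{n+1}\to 0$. This makes every supremum `growth M t` finite. -/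
theorem IsWeightSequence.tendsto_pow_div {M : ℕ → ℝ} (hM : IsWeightSequence M) (t : ℝ) :
    Tendsto (fun n => t ^ n / M n) atTop (𝓝 0) := by
  refine Summable.tendsto_atTop_zero ?_
  refine summable_of_ratio_norm_eventually_le (r := 1 / 2) (by norm_num) ?_
  filter_upwards [hM.2.eventually_ge_atTop (2 * |t|)] with n hn
  have h0 := hM.1 n
  have h1 := hM.1 (n + 1)
  rw [le_div_iff₀ h0] at hn
  simp only [norm_div, norm_pow, Real.norm_eq_abs, abs_of_pos h0, abs_of_pos h1]
  rw [div_mul_div_comm, div_le_div_iff₀ h1 (by positivity), pow_succ]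
  have := mul_le_mul_of_nonneg_left hn (pow_nonneg (abs_nonneg t) n)
  linarith

theorem IsWeightSequence.bddAbove_pow_div {M : ℕ → ℝ} (hM : IsWeightSequence M) (t : ℝ) :
    BddAbove (Set.range fun n : ℕ => t ^ n / M n) :=
  (hM.tendsto_pow_div t).bddAbove_range

theorem IsWeightSequence.pow_div_le_growth {M : ℕ → ℝ} (hM : IsWeightSequence M) (t : ℝ) (n : ℕ) :
    t ^ n / M n ≤ growth M t :=
  le_ciSup (hM.bddAbove_pow_div t) n

theorem IsWeightSequence.pow_le_growth {M : ℕ → ℝ} (hM : IsWeightSequence M) (t : ℝ) (n : ℕ) :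
    t ^ n ≤ M n * growth M t := by
  have := hM.pow_div_le_growth t n
  rwa [div_le_iff₀ (hM.1 n), mul_comm] at this

theorem IsWeightSequence.growth_pos {M : ℕ → ℝ} (hM : IsWeightSequence M) (t : ℝ) :
    0 < growth M t :=
  lt_of_lt_of_le (by simpa using hM.1 0) (hM.pow_div_le_growth t 0)

theorem IsWeightSequence.growth_mono {M : ℕ → ℝ} (hM : IsWeightSequence M) {s t : ℝ}
    (hs : 0 ≤ s) (hst : s ≤ t) : growth M s ≤ growth M t := by
  refine ciSup_le fun n => le_trans ?_ (hM.pow_div_le_growth t n)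
  have := hM.1 n
  gcongr

/-- By $(M.2)'$, $t\cdot t^n/M_n\le C_0H^n t^{n+1}/M_{n+1}$: a factor $t$ shifts the index by one
and costs only a dilation. -/
theorem IsWeightSequence.exists_one_add_mul_growth_le {M : ℕ → ℝ} (hM : IsWeightSequence M)
    (hM2 : CondM2' M) :
    ∃ C H : ℝ, 0 < C ∧ 1 ≤ H ∧ ∀ t, 0 ≤ t → (1 + t) * growth M t ≤ C * growth M (H * t) := by
  obtain ⟨C₀, H, hC, hH, h⟩ := hM2
  refine ⟨1 + C₀, H, by linarith, hH, fun t ht => ?_⟩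
  have h1 : growth M t ≤ growth M (H * t) :=
    hM.growth_mono ht (le_mul_of_one_le_left ht hH)
  have h2 : t * growth M t ≤ C₀ * growth M (H * t) := by
    rw [growth, Real.mul_iSup_of_nonneg ht]
    refine ciSup_le fun n => ?_
    have h3 := hM.pow_le_growth (H * t) (n + 1)
    have h0 := hM.1 n
    have hg := hM.growth_pos (H * t)
    rw [← mul_div_assoc, div_le_iff₀ h0]
    have h4 : t * t ^ n * H ^ (n + 1) ≤ C₀ * H ^ (n + 1) * M n * growth M (H * t) := by
      calc t * t ^ n * H ^ (n + 1) = (H * t) ^ (n + 1) := by ring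
        _ ≤ M (n + 1) * growth M (H * t) := h3
        _ ≤ C₀ * H ^ n * M n * growth M (H * t) := by gcongr; exact h n
        _ ≤ C₀ * H ^ (n + 1) * M n * growth M (H * t) := by
          gcongr
          omega
    have hHp : 0 < H ^ (n + 1) := by positivity
    refine le_of_mul_le_mul_right ?_ hHp
    linarith
  linarith

/-- The one-factor estimate is iterated $q$ times. The dilation $K$ is chosen before $h$, so that
$h/K$ may later be substituted for $h$. -/
theorem IsWeightSequence.exists_one_add_pow_mul_growth_le {M : ℕ → ℝ} (hM : IsWeightSequence M)
    (hM2 : CondM2' M) (q : ℕ) :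
    ∃ K : ℝ, 1 ≤ K ∧ ∀ h, 0 < h → ∃ C, 0 < C ∧ ∀ t, 0 ≤ t →
      (1 + t) ^ q * growth M (h * t) ≤ C * growth M (K * h * t) := by
  obtain ⟨C₁, H, hC₁, hH, h₁⟩ := hM.exists_one_add_mul_growth_le hM2
  refine ⟨H ^ q, one_le_pow₀ hH, fun h hh => ?_⟩
  -- This factor compensates for small $h$: it gives $1+t\le c(1+H^q h t)$ at each stage.
  set c := max 1 h⁻¹ with hc
  have hc1 : 1 ≤ c := le_max_left _ _
  have hc2 : 1 ≤ c * h := by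
    have : h⁻¹ ≤ c := le_max_right _ _
    calc (1 : ℝ) = h⁻¹ * h := (inv_mul_cancel₀ hh.ne').symm
      _ ≤ _ := by gcongr
  refine ⟨(c * C₁) ^ q, by positivity, fun t ht => ?_⟩
  induction q with
  | zero => simp
  | succ q ih =>
    have hq : 0 ≤ H ^ q * h * t := by positivity
    have h2 := h₁ (H ^ q * h * t) hq
    have h3 : 1 + t ≤ c * (1 + H ^ q * h * t) := by
      have hHq : 1 ≤ H ^ q := one_le_pow₀ hH
      have : t ≤ c * (H ^ q * h * t) := by
        calc t ≤ (c * h) * t := le_mul_of_one_le_left ht hc2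
          _ ≤ (c * h) * t * H ^ q := le_mul_of_one_le_right (by positivity) hHq
          _ = _ := by ring
      linarith
    have hg := hM.growth_pos (H ^ q * h * t)
    calc (1 + t) ^ (q + 1) * growth M (h * t)
        = (1 + t) * ((1 + t) ^ q * growth M (h * t)) := by ring
      _ ≤ (1 + t) * ((c * C₁) ^ q * growth M (H ^ q * h * t)) := by gcongr
      _ ≤ (c * (1 + H ^ q * h * t)) * ((c * C₁) ^ q * growth M (H ^ q * h * t)) := by gcongr
      _ = c * (c * C₁) ^ q * ((1 + H ^ q * h * t) * growth M (H ^ q * h * t)) := by ring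
      _ ≤ c * (c * C₁) ^ q * (C₁ * growth M (H * (H ^ q * h * t))) := by gcongr
      _ = _ := by
        rw [show H * (H ^ q * h * t) = H ^ (q + 1) * h * t by ring]; ring

/-- Doubling the argument gains $2^n$ on the $n$-th term, which suffices for $n\ge n_0$. Each of the
finitely many remaining terms is compared with its successor, which gains a factor $t$. -/
theorem IsWeightSequence.exists_growth_le_mul {M : ℕ → ℝ} (hM : IsWeightSequence M) {δ : ℝ}
    (hδ : 0 < δ) : ∃ ρ : ℝ, 0 < ρ ∧ ∀ t, ρ ≤ t → growth M t ≤ δ * growth M (2 * t) := by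
  obtain ⟨n₀, hn₀⟩ := exists_pow_lt_of_lt_one hδ (by norm_num : (1 / 2 : ℝ) < 1)
  set S := ∑ n ∈ Finset.range n₀, M (n + 1) / M n with hS
  have hS0 : 0 ≤ S := Finset.sum_nonneg fun n _ => (div_pos (hM.1 _) (hM.1 _)).le
  refine ⟨S / δ + 1, by positivity, fun t ht => ?_⟩
  have ht0 : 0 < t := lt_of_lt_of_le (by positivity) ht
  have hg := hM.growth_pos (2 * t)
  refine ciSup_le fun n => ?_
  have hMn := hM.1 n
  rw [div_le_iff₀ hMn]
  rcases lt_or_ge n n₀ with hn | hn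
  · have h1 : M (n + 1) / M n ≤ S :=
      Finset.single_le_sum (f := fun n => M (n + 1) / M n)
        (fun n _ => (div_pos (hM.1 _) (hM.1 _)).le) (Finset.mem_range.2 hn)
    rw [div_le_iff₀ hMn] at h1
    have h2 : S ≤ δ * t := by
      have : S / δ ≤ t := by linarith
      rwa [div_le_iff₀ hδ, mul_comm] at this
    have h3 : t ^ (n + 1) ≤ M (n + 1) * growth M (2 * t) :=
      le_trans (pow_le_pow_left₀ ht0.le (by linarith) _) (hM.pow_le_growth (2 * t) (n + 1))
    refine le_of_mul_le_mul_right ?_ ht0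
    calc t ^ n * t = t ^ (n + 1) := by ring
      _ ≤ M (n + 1) * growth M (2 * t) := h3
      _ ≤ (δ * t * M n) * growth M (2 * t) := by
        gcongr
        exact h1.trans (by gcongr)
      _ = _ := by ring
  · have h1 : (1 / 2 : ℝ) ^ n ≤ δ :=
      (pow_le_pow_of_le_one (by norm_num) (by norm_num) hn).trans hn₀.le
    calc t ^ n = (1 / 2) ^ n * (2 * t) ^ n := by rw [← mul_pow]; congr 1; ring
      _ ≤ δ * (M n * growth M (2 * t)) := by gcongr; exact hM.pow_le_growth _ _
      _ = _ := by ring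

/-- At $t=0$ both conventions intervene: $\log 0=0$ on the left, $0^0=1$ on the right. -/
theorem IsWeightSequence.exp_associatedFun {A : ℕ → ℝ} (hA : IsWeightSequence A) {t : ℝ}
    (ht : 0 ≤ t) : Real.exp (associatedFun A t) = A 0 * growth A t := by
  have hA0 := hA.1 0
  rcases ht.eq_or_lt with rfl | ht
  · have h1 : associatedFun A 0 = 0 := by
      have : ∀ p : ℕ, Real.log (0 ^ p * A 0 / A p) = 0 := by
        rintro (_ | p)
        · simp [hA0.ne']
        · simp
      simp [associatedFun, this]
    have h2 : growth A 0 = 1 / A 0 := by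
      refine le_antisymm (ciSup_le fun n => ?_) (by simpa using hA.pow_div_le_growth 0 0)
      rcases n with _ | n
      · simp
      · simp [hA0.le]
    rw [h1, h2, Real.exp_zero, mul_one_div_cancel hA0.ne']
  · have hpos : ∀ p, 0 < t ^ p * A 0 / A p := fun p => by
      have := hA.1 p
      positivity
    have hle : ∀ p, t ^ p * A 0 / A p ≤ A 0 * growth A t := fun p => by
      have := mul_le_mul_of_nonneg_left (hA.pow_div_le_growth t p) hA0.le
      calc _ = A 0 * (t ^ p / A p) := by ring
        _ ≤ _ := this
    have hg : 0 < A 0 * growth A t := mul_pos hA0 (hA.growth_pos t)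
    have hbdd : BddAbove (Set.range fun p : ℕ => Real.log (t ^ p * A 0 / A p)) :=
      ⟨Real.log (A 0 * growth A t), by
        rintro _ ⟨p, rfl⟩
        exact Real.log_le_log (hpos p) (hle p)⟩
    refine le_antisymm ?_ ?_
    · rw [← Real.le_log_iff_exp_le hg]
      exact ciSup_le fun p => Real.log_le_log (hpos p) (hle p)
    · rw [growth, Real.mul_iSup_of_nonneg hA0.le]
      refine ciSup_le fun p => ?_
      rw [show A 0 * (t ^ p / A p) = t ^ p * A 0 / A p by ring, ← Real.log_le_iff_le_exp (hpos p)]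
      exact le_ciSup hbdd p

/-- Log-convex sequences satisfy `M_j M_m ≤ M_0 M_{j+m}`. -/
theorem IsWeightSequence.mul_le_of_condM1 {M : ℕ → ℝ} (hM : IsWeightSequence M) (hM1 : CondM1 M)
    (j m : ℕ) : M j * M m ≤ M 0 * M (j + m) := by
  have hmono : Monotone fun p => M (p + 1) / M p := by
    refine monotone_nat_of_le_succ fun p => ?_
    rw [div_le_div_iff₀ (hM.1 _) (hM.1 _)]
    have := hM1 p
    nlinarith
  induction j with
  | zero => simp
  | succ j ih =>
    have h1 := hmono (Nat.le_add_right j m)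
    simp only at h1
    rw [div_le_div_iff₀ (hM.1 _) (hM.1 _)] at h1
    have hj := hM.1 j
    have hjm := hM.1 (j + m)
    have hj1 := hM.1 (j + 1)
    refine le_of_mul_le_mul_right ?_ (mul_pos hj hjm)
    calc M (j + 1) * M m * (M j * M (j + m)) = (M (j + 1) * M (j + m)) * (M j * M m) := by ring
      _ ≤ (M (j + m + 1) * M j) * (M 0 * M (j + m)) := by
        have := hM.1 (j + m + 1); have := hM.1 m
        gcongr
      _ = M 0 * M (j + 1 + m) * (M j * M (j + m)) := by
        rw [show j + 1 + m = j + m + 1 by ring]; ring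

/-! ### Slowly increasing sequences in the Komatsu family -/

/-- There are sequences of the Komatsu family that increase as slowly as one likes. -/
theorem exists_komatsuFamily_prod_le (b : ℕ → ℕ) :
    ∃ r ∈ KomatsuFamily, ∀ k n, n ≤ b k → ∏ j ∈ Finset.range (n + 1), r j ≤ ((k : ℝ) + 1) ^ n := by
  -- A nondecreasing, unbounded majorant of $b$. Its generalized inverse $\kappa$ gives the sequence
  -- $r_j=\kappa_j+1$, which is at most $k+1$ for $j\le c_k$.
  set c : ℕ → ℕ := fun k => k + ∑ i ∈ Finset.range (k + 1), b i with hc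
  have hbc : ∀ k, b k ≤ c k := fun k =>
    (Finset.single_le_sum (f := b) (fun _ _ => Nat.zero_le _) (Finset.self_mem_range_succ k)).trans
      (Nat.le_add_left _ _)
  have hex : ∀ j, ∃ k, j ≤ c k := fun j => ⟨j, Nat.le_add_right _ _⟩
  have hcm : Monotone c := fun i j hij => by
    simp only [hc]
    have : ∑ i ∈ Finset.range (i + 1), b i ≤ ∑ i ∈ Finset.range (j + 1), b i :=
      Finset.sum_le_sum_of_subset (Finset.range_mono (by omega))
    omega
  set κ : ℕ → ℕ := fun j => Nat.find (hex j) with hκ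
  have hκle : ∀ k j, j ≤ c k → κ j ≤ k := fun k j h => Nat.find_min' (hex j) h
  have hκmono : Monotone κ := fun i j hij => hκle _ _ (hij.trans (Nat.find_spec (hex j)))
  have hκtop : Tendsto κ atTop atTop := by
    refine tendsto_atTop_atTop.2 fun k => ⟨c k + 1, fun j hj => ?_⟩
    by_contra hlt
    have h1 : j ≤ c (κ j) := Nat.find_spec (hex j)
    have h2 : c (κ j) ≤ c k := hcm (by omega)
    omega
  refine ⟨fun j => (κ j : ℝ) + 1, ⟨fun j => by positivity, fun i j hij => ?_, ?_⟩, ?_⟩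
  · simpa using hκmono hij
  · exact tendsto_atTop_add_const_right _ _ (tendsto_natCast_atTop_atTop.comp hκtop)
  · intro k n hn
    -- Hence $r_0=1$, so the product of $n+1$ factors is bounded by an $n$-th power.
    have h0 : κ 0 = 0 := Nat.le_zero.1 (hκle 0 0 (Nat.zero_le _))
    rw [Finset.prod_range_succ', h0]
    simp only [Nat.cast_zero, zero_add, mul_one]
    calc _ ≤ ∏ j ∈ Finset.range n, ((k : ℝ) + 1) := by
          refine Finset.prod_le_prod (fun _ _ => by positivity) fun j hj => ?_
          have : κ (j + 1) ≤ k := hκle _ _ (by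
            have := Finset.mem_range.1 hj; have := hbc k; omega)
          have : (κ (j + 1) : ℝ) ≤ k := by exact_mod_cast this
          linarith
      _ = _ := by simp

/-- The quotient $c^n/\prod_{j\le n} r_j$ is nonincreasing once $r_j\ge c$, so finitely many values
bound it. -/
theorem exists_pow_le_mul_prod {r : ℕ → ℝ} (hr : r ∈ KomatsuFamily) (c : ℝ) (hc : 0 ≤ c) :
    ∃ C, 0 < C ∧ ∀ n, c ^ n ≤ C * ∏ j ∈ Finset.range (n + 1), r j := by
  obtain ⟨hpos, hmono, htop⟩ := hr
  obtain ⟨n₀, hn₀⟩ := (htop.eventually_ge_atTop c).exists_forall_of_atTop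
  have hP : ∀ n, 0 < ∏ j ∈ Finset.range (n + 1), r j := fun n => Finset.prod_pos fun j _ => hpos j
  set f : ℕ → ℝ := fun n => c ^ n / ∏ j ∈ Finset.range (n + 1), r j with hf
  have hf0 : ∀ n, 0 ≤ f n := fun n => div_nonneg (by positivity) (hP n).le
  have hstep : ∀ n, n₀ ≤ n → f (n + 1) ≤ f n := fun n hn => by
    simp only [hf]
    rw [div_le_div_iff₀ (hP _) (hP _), Finset.prod_range_succ _ (n + 1), pow_succ]
    have := hn₀ (n + 1) (by omega)
    have h1 := hP n
    calc c ^ n * c * ∏ j ∈ Finset.range (n + 1), r j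
        ≤ c ^ n * r (n + 1) * ∏ j ∈ Finset.range (n + 1), r j := by gcongr
      _ = _ := by ring
  set C := ∑ n ∈ Finset.range (n₀ + 1), f n with hC
  have hle : ∀ n, n ≤ n₀ → f n ≤ C := fun n hn =>
    Finset.single_le_sum (fun n _ => hf0 n) (Finset.mem_range.2 (by omega))
  have hall : ∀ n, f n ≤ C := fun n => by
    rcases le_total n n₀ with h | h
    · exact hle n h
    · induction n, h using Nat.le_induction with
      | base => exact hle _ le_rfl
      | succ n hn ih => exact (hstep n hn).trans ih
  refine ⟨C + 1, by linarith [hf0 0, hall 0], fun n => ?_⟩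
  have := hall n
  simp only [hf] at this
  rw [div_le_iff₀ (hP n)] at this
  nlinarith [hP n]

/-! ### Multi-index derivatives and iterated Fréchet derivatives -/

section multiDeriv

variable {d : ℕ} {f : EuclideanSpace ℝ (Fin d) → ℂ}

theorem contDiff_foldr_list_partialDeriv (hf : ContDiff ℝ ∞ f) (L : List (Fin d)) :
    ContDiff ℝ ∞ (L.foldr partialDeriv f) := by
  induction L with
  | nil => exact hf
  | cons i L ih => exact contDiff_partialDeriv i ih

theorem iteratedFDeriv_apply_single (hf : ContDiff ℝ ∞ f) {n : ℕ} (m : Fin n → Fin d)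
    (x : EuclideanSpace ℝ (Fin d)) :
    iteratedFDeriv ℝ n f x (fun j => EuclideanSpace.single (m j) 1) =
      (List.ofFn m).foldr partialDeriv f x := by
  induction n generalizing x with
  | zero => simp
  | succ n ih =>
    rw [List.ofFn_succ, List.foldr_cons, partialDeriv, iteratedFDeriv_succ_apply_left]
    have h : (List.ofFn fun i : Fin n => m i.succ).foldr partialDeriv f =
        fun y => iteratedFDeriv ℝ n f y (fun j => EuclideanSpace.single (m j.succ) 1) := by
      funext y
      exact (ih (fun j => m j.succ) y).symm
    have hd : DifferentiableAt ℝ (iteratedFDeriv ℝ n f) x :=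
      (hf.differentiable_iteratedFDeriv (m := n) (by exact_mod_cast WithTop.coe_lt_top _)) x
    rw [h, fderiv_continuousMultilinear_apply_const_apply hd]
    rfl

theorem partialDeriv_comm (hf : ContDiff ℝ ∞ f) (i j : Fin d) :
    partialDeriv i (partialDeriv j f) = partialDeriv j (partialDeriv i f) := by
  have h : ∀ (i j : Fin d) x, partialDeriv i (partialDeriv j f) x =
      fderiv ℝ (fderiv ℝ f) x (EuclideanSpace.single i 1) (EuclideanSpace.single j 1) := by
    intro i j x
    have hd : DifferentiableAt ℝ (fderiv ℝ f) x :=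
      ((hf.fderiv_right (m := ∞) (by simp)).differentiable (by simp)) x
    have := fderiv_clm_apply hd (differentiableAt_const (EuclideanSpace.single j (1 : ℝ)))
    change fderiv ℝ (fun y => (fderiv ℝ f y) (EuclideanSpace.single j 1)) x _ = _
    rw [this]
    simp
  funext x
  rw [h, h]
  exact (hf.contDiffAt.isSymmSndFDerivAt (by
    rw [minSmoothness_of_isRCLikeNormedField]; exact WithTop.coe_le_coe.2 (le_top : (2 : ℕ∞) ≤ ⊤))).eq _ _

theorem foldr_partialDeriv_perm (hf : ContDiff ℝ ∞ f) {L₁ L₂ : List (Fin d)}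
    (h : L₁.Perm L₂) : L₁.foldr partialDeriv f = L₂.foldr partialDeriv f := by
  induction h with
  | nil => rfl
  | cons i _ ih => rw [List.foldr_cons, List.foldr_cons, ih]
  | swap i j L => exact partialDeriv_comm (contDiff_foldr_list_partialDeriv hf L) j i
  | trans _ _ ih₁ ih₂ => exact ih₁.trans ih₂

/-- The nondecreasing list in which `i` occurs `α i` times. -/
def multiIndexList (α : Fin d → ℕ) : List (Fin d) :=
  (List.finRange d).flatMap fun i => List.replicate (α i) i

theorem length_multiIndexList (α : Fin d → ℕ) : (multiIndexList α).length = multiLength α := by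
  simp [multiIndexList, multiLength, List.length_flatMap, List.sum_ofFn, ← List.ofFn_eq_map]

theorem multiDeriv_eq_foldr (α : Fin d → ℕ) :
    multiDeriv α f = (multiIndexList α).foldr partialDeriv f := by
  rw [multiDeriv, multiIndexList, List.foldr_flatMap]
  congr 1
  funext i g
  generalize α i = n
  induction n with
  | zero => rfl
  | succ n ih => rw [Function.iterate_succ_apply', ih, List.replicate_succ, List.foldr_cons]

theorem perm_multiIndexList_count (L : List (Fin d)) :
    L.Perm (multiIndexList fun i => L.count i) := by
  rw [List.perm_iff_count]
  intro i
  rw [multiIndexList, List.count_flatMap]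
  have : (List.count i ∘ fun j => List.replicate (L.count j) j) =
      fun j => if j = i then L.count i else 0 := by
    funext j
    by_cases h : j = i
    · subst h; simp
    · simp [List.count_replicate, h]
  rw [this, ← List.ofFn_eq_map, List.sum_ofFn]
  simp

theorem norm_multiDeriv_le (hf : ContDiff ℝ ∞ f) (α : Fin d → ℕ)
    (x : EuclideanSpace ℝ (Fin d)) :
    ‖multiDeriv α f x‖ ≤ ‖iteratedFDeriv ℝ (multiLength α) f x‖ := by
  rw [multiDeriv_eq_foldr, ← length_multiIndexList]
  set L := multiIndexList α
  have h := iteratedFDeriv_apply_single hf L.get x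
  rw [List.ofFn_get] at h
  rw [← h]
  refine (ContinuousMultilinearMap.le_opNorm _ _).trans ?_
  simp

/-- Expanding each argument in the standard basis gives $d^n$ terms, and symmetry of the derivatives
sorts each into a multi-index derivative. The loss $d^n$ is geometric, hence harmless after a change
of $h$. -/
theorem norm_iteratedFDeriv_le_of_multiDeriv (hf : ContDiff ℝ ∞ f) (n : ℕ)
    (x : EuclideanSpace ℝ (Fin d)) {B : ℝ} (hB : 0 ≤ B)
    (h : ∀ α : Fin d → ℕ, multiLength α = n → ‖multiDeriv α f x‖ ≤ B) :
    ‖iteratedFDeriv ℝ n f x‖ ≤ (d : ℝ) ^ n * B := by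
  refine ContinuousMultilinearMap.opNorm_le_bound (by positivity) fun v => ?_
  have hm : ∀ m : Fin n → Fin d,
      ‖iteratedFDeriv ℝ n f x (fun j => EuclideanSpace.single (m j) 1)‖ ≤ B := by
    intro m
    rw [iteratedFDeriv_apply_single hf, foldr_partialDeriv_perm hf (perm_multiIndexList_count _),
      ← multiDeriv_eq_foldr]
    refine h _ ?_
    rw [← length_multiIndexList, ← (perm_multiIndexList_count _).length_eq, List.length_ofFn]
  have hv : v = fun j => ∑ i, v j i • EuclideanSpace.single i (1 : ℝ) := by
    funext j
    have := (EuclideanSpace.basisFun (Fin d) ℝ).sum_repr (v j)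
    simpa using this.symm
  have hsum : iteratedFDeriv ℝ n f x v = ∑ m : Fin n → Fin d, (∏ j, v j (m j)) •
      iteratedFDeriv ℝ n f x (fun j => EuclideanSpace.single (m j) 1) := by
    conv_lhs => rw [hv]
    rw [ContinuousMultilinearMap.map_sum]
    refine Finset.sum_congr rfl fun m _ => ?_
    rw [ContinuousMultilinearMap.map_smul_univ]
  rw [hsum]
  refine (norm_sum_le _ _).trans ?_
  calc _ ≤ ∑ _m : Fin n → Fin d, B * ∏ j, ‖v j‖ := by
        refine Finset.sum_le_sum fun m _ => ?_
        rw [norm_smul, norm_prod, mul_comm]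
        gcongr with j
        · exact hm m
        · exact PiLp.norm_apply_le _ _
    _ = _ := by simp [mul_assoc]

end multiDeriv

/-! ### Weighted norms expressed through Fréchet derivatives -/

section weightedSup

variable {d : ℕ} {N : ℕ → ℝ} {v : EuclideanSpace ℝ (Fin d) → ℝ}
  {f : EuclideanSpace ℝ (Fin d) → ℂ}

theorem weightedSup_le_of_iteratedFDeriv (hf : ContDiff ℝ ∞ f) (hN : ∀ n, 0 < N n)
    (hv : ∀ x, 0 ≤ v x) {C : ℝ} (h : ∀ n x, ‖iteratedFDeriv ℝ n f x‖ * v x ≤ C * N n) :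
    weightedSup N v f ≤ ENNReal.ofReal C := by
  refine iSup₂_le fun α x => ?_
  rw [← ofReal_norm, ← ENNReal.ofReal_mul (norm_nonneg _)]
  refine ENNReal.ofReal_le_ofReal ?_
  rw [← mul_div_assoc, div_le_iff₀ (hN _)]
  refine le_trans ?_ (h _ x)
  exact mul_le_mul_of_nonneg_right (norm_multiDeriv_le hf α x) (hv x)

theorem norm_multiDeriv_mul_le (hN : ∀ n, 0 < N n) (hv : ∀ x, 0 ≤ v x)
    (h : weightedSup N v f < ⊤) (α : Fin d → ℕ) (x : EuclideanSpace ℝ (Fin d)) :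
    ‖multiDeriv α f x‖ * v x ≤ (weightedSup N v f).toReal * N (multiLength α) := by
  have h1 : ‖multiDeriv α f x‖ₑ * ENNReal.ofReal (v x / N (multiLength α)) ≤ weightedSup N v f :=
    le_iSup₂ (f := fun α x => ‖multiDeriv α f x‖ₑ *
          ENNReal.ofReal (v x / N (multiLength α))) α x
  have h2 := ENNReal.toReal_mono h.ne h1
  rw [ENNReal.toReal_mul, toReal_enorm, ENNReal.toReal_ofReal (div_nonneg (hv x) (hN _).le),
    ← mul_div_assoc, div_le_iff₀ (hN _)] at h2
  exact h2

theorem norm_iteratedFDeriv_mul_le_weightedSup (hf : ContDiff ℝ ∞ f) (hN : ∀ n, 0 < N n)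
    (hv : ∀ x, 0 < v x) (h : weightedSup N v f < ⊤) (n : ℕ) (x : EuclideanSpace ℝ (Fin d)) :
    ‖iteratedFDeriv ℝ n f x‖ * v x ≤ (weightedSup N v f).toReal * ((d : ℝ) ^ n * N n) := by
  rw [← le_div_iff₀ (hv x)]
  refine (norm_iteratedFDeriv_le_of_multiDeriv hf n x
    (B := (weightedSup N v f).toReal * N n / v x) ?_ fun α hα => ?_).trans (le_of_eq ?_)
  · have := hv x; have := hN n; positivity
  · rw [le_div_iff₀ (hv x), ← hα]
    exact norm_multiDeriv_mul_le hN (fun x => (hv x).le) h α x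
  · ring

end weightedSup

/-! ### Smoothness of parametric integrals -/

section ParametricIntegral

variable {Z E F : Type*} [NormedAddCommGroup E] [NormedSpace ℝ E]
  [NormedAddCommGroup F] [NormedSpace ℝ F]

/-- Joint smoothness in parameter and variable gives the measurability in the parameter needed to
differentiate the synthesis integral. -/
theorem contDiff_iteratedFDeriv_uncurry [NormedAddCommGroup Z] [NormedSpace ℝ Z] {K : Z → E → F}
    (hK : ContDiff ℝ ∞ (Function.uncurry K)) (n : ℕ) :
    ContDiff ℝ ∞ (fun p : Z × E => iteratedFDeriv ℝ n (K p.1) p.2) := by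
  induction n with
  | zero =>
    simp only [iteratedFDeriv_zero_eq_comp, Function.comp_def]
    exact (LinearIsometryEquiv.contDiff _).comp hK
  | succ n ih =>
    simp only [iteratedFDeriv_succ_eq_comp_left, Function.comp_def]
    have h : ContDiff ℝ ∞ fun p : Z × E => fderiv ℝ (iteratedFDeriv ℝ n (K p.1)) p.2 :=
      ContDiff.fderiv (m := ∞) (f := fun (p : Z × E) y => iteratedFDeriv ℝ n (K p.1) y)
        (g := fun p => p.2) (ih.comp ((contDiff_fst.comp contDiff_fst).prodMk contDiff_snd))
        contDiff_snd (by simp)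
    exact (LinearIsometryEquiv.contDiff (𝕜 := ℝ) (E := E →L[ℝ] E [×n]→L[ℝ] F)
      (F := E [×(n + 1)]→L[ℝ] F)
      (continuousMultilinearCurryLeftEquiv ℝ (fun _ : Fin (n + 1) => E) F).symm).comp h

variable [MeasurableSpace Z] {μ : Measure Z} {K : Z → E → F}

theorem hasFDerivAt_integral_iteratedFDeriv [CompleteSpace F] (hK : ∀ z, ContDiff ℝ ∞ (K z))
    (hmeas : ∀ n t, AEStronglyMeasurable (fun z => iteratedFDeriv ℝ n (K z) t) μ)
    (hb : ∀ (n : ℕ) (t₀ : E), ∃ bound : Z → ℝ, Integrable bound μ ∧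
      ∀ z, ∀ t ∈ Metric.ball t₀ 1, ‖iteratedFDeriv ℝ n (K z) t‖ ≤ bound z) (n : ℕ) (t₀ : E) :
    HasFDerivAt (𝕜 := ℝ) (fun t => ∫ z, iteratedFDeriv ℝ n (K z) t ∂μ)
      (∫ z, fderiv ℝ (iteratedFDeriv ℝ n (K z)) t₀ ∂μ) t₀ := by
  obtain ⟨b₀, hb₀, hb₀'⟩ := hb n t₀
  obtain ⟨b₁, hb₁, hb₁'⟩ := hb (n + 1) t₀
  refine hasFDerivAt_integral_of_dominated_of_fderiv_le (𝕜 := ℝ) (bound := b₁)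
    (F' := fun t z => fderiv ℝ (iteratedFDeriv ℝ n (K z)) t)
    (Metric.ball_mem_nhds t₀ one_pos) (Eventually.of_forall fun t => hmeas n t) ?_ ?_
    (Eventually.of_forall fun z t ht => ?_) hb₁ (Eventually.of_forall fun z t ht => ?_)
  · exact hb₀.mono' (hmeas n t₀)
      (Eventually.of_forall fun z => hb₀' z t₀ (Metric.mem_ball_self one_pos))
  · have h := hmeas (n + 1) t₀
    simp only [iteratedFDeriv_succ_eq_comp_left, Function.comp_def] at h
    have h2 := (LinearIsometryEquiv.continuous
      (continuousMultilinearCurryLeftEquiv ℝ (fun _ : Fin (n + 1) => E) F)).comp_aestronglyMeasurable h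
    simpa [Function.comp_def] using h2
  · rw [norm_fderiv_iteratedFDeriv]
    exact hb₁' z t ht
  · exact (((hK z).differentiable_iteratedFDeriv (m := n)
      (by exact_mod_cast WithTop.coe_lt_top _)) t).hasFDerivAt

theorem iteratedFDeriv_integral [CompleteSpace F] (hK : ∀ z, ContDiff ℝ ∞ (K z))
    (hmeas : ∀ n t, AEStronglyMeasurable (fun z => iteratedFDeriv ℝ n (K z) t) μ)
    (hb : ∀ (n : ℕ) (t₀ : E), ∃ bound : Z → ℝ, Integrable bound μ ∧
      ∀ z, ∀ t ∈ Metric.ball t₀ 1, ‖iteratedFDeriv ℝ n (K z) t‖ ≤ bound z) (n : ℕ) :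
    iteratedFDeriv ℝ n (fun t => ∫ z, K z t ∂μ) =
      fun t => ∫ z, iteratedFDeriv ℝ n (K z) t ∂μ := by
  induction n with
  | zero =>
    funext t
    simp only [iteratedFDeriv_zero_eq_comp, Function.comp_def]
    exact (LinearIsometryEquiv.toContinuousLinearEquiv
      (continuousMultilinearCurryFin0 ℝ E F).symm).integral_comp_comm _ |>.symm
  | succ n ih =>
    funext t
    simp only [iteratedFDeriv_succ_eq_comp_left, Function.comp_def]
    rw [ih, (hasFDerivAt_integral_iteratedFDeriv hK hmeas hb n t).fderiv]
    exact (ContinuousLinearEquiv.integral_comp_comm (𝕜 := ℝ) (E := E →L[ℝ] E [×n]→L[ℝ] F)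
      (F := E [×(n + 1)]→L[ℝ] F) (LinearIsometryEquiv.toContinuousLinearEquiv
      (continuousMultilinearCurryLeftEquiv ℝ (fun _ : Fin (n + 1) => E) F).symm)
        (fun z => fderiv ℝ (iteratedFDeriv ℝ n (K z)) t)).symm

theorem contDiff_integral [CompleteSpace F] (hK : ∀ z, ContDiff ℝ ∞ (K z))
    (hmeas : ∀ n t, AEStronglyMeasurable (fun z => iteratedFDeriv ℝ n (K z) t) μ)
    (hb : ∀ (n : ℕ) (t₀ : E), ∃ bound : Z → ℝ, Integrable bound μ ∧
      ∀ z, ∀ t ∈ Metric.ball t₀ 1, ‖iteratedFDeriv ℝ n (K z) t‖ ≤ bound z) :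
    ContDiff ℝ ∞ (fun t => ∫ z, K z t ∂μ) := by
  refine contDiff_of_differentiable_iteratedFDeriv fun m _ => ?_
  rw [iteratedFDeriv_integral hK hmeas hb]
  exact fun t => (hasFDerivAt_integral_iteratedFDeriv hK hmeas hb m t).differentiableAt

end ParametricIntegral

/-! ### Fourier transforms and plane waves -/

section Fourier

open scoped FourierTransform RealInnerProductSpace

variable {V : Type*} [NormedAddCommGroup V] [InnerProductSpace ℝ V]

/-- The plane wave `t ↦ exp (2πi ⟨ξ, t⟩)`. -/
def planeWave (ξ t : V) : ℂ := Complex.exp (((2 * Real.pi * ⟪ξ, t⟫ : ℝ) : ℂ) * Complex.I)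

theorem contDiff_planeWave : ContDiff ℝ ∞ (fun p : V × V => planeWave p.1 p.2) := by
  unfold planeWave
  refine ContDiff.cexp (ContDiff.mul ?_ contDiff_const)
  refine Complex.ofRealCLM.contDiff.comp ?_
  exact contDiff_const.mul (contDiff_fst.inner ℝ contDiff_snd)

theorem norm_iteratedFDeriv_planeWave_le (ξ t : V) (n : ℕ) :
    ‖iteratedFDeriv ℝ n (planeWave ξ) t‖ ≤ (2 * Real.pi * ‖ξ‖) ^ n := by
  set g : ℝ → ℂ := fun u => Complex.exp ((u : ℂ) * Complex.I) with hg
  have hgd : ContDiff ℝ ∞ g := ContDiff.cexp (Complex.ofRealCLM.contDiff.mul contDiff_const)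
  have hgn : ∀ n : ℕ, iteratedDeriv n g = fun u => Complex.I ^ n * g u := by
    intro n
    induction n with
    | zero => simp
    | succ n ih =>
      rw [iteratedDeriv_succ, ih]
      funext u
      have h1 : HasDerivAt g (Complex.exp ((u : ℂ) * Complex.I) * (1 * Complex.I)) u :=
        ((Complex.ofRealCLM.hasDerivAt (x := u)).mul_const Complex.I).cexp
      rw [(h1.const_mul (Complex.I ^ n)).deriv]
      simp only [hg]
      ring
  set L : V →L[ℝ] ℝ := (2 * Real.pi) • innerSL ℝ ξ with hL
  have hLn : ‖L‖ ≤ 2 * Real.pi * ‖ξ‖ := by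
    rw [hL, norm_smul, innerSL_apply_norm, Real.norm_of_nonneg (by positivity)]
  have he : planeWave ξ = g ∘ L := by
    funext t
    simp [planeWave, hg, hL]
  rw [he, L.iteratedFDeriv_comp_right hgd t (by exact_mod_cast le_top)]
  refine (ContinuousMultilinearMap.norm_compContinuousLinearMap_le _ _).trans ?_
  rw [norm_iteratedFDeriv_eq_norm_iteratedDeriv, hgn]
  have : ‖g (L t)‖ = 1 := Complex.norm_exp_ofReal_mul_I _
  simp only [norm_mul, norm_pow, Complex.norm_I, one_pow, this, one_mul, Finset.prod_const,
    Finset.card_univ, Fintype.card_fin]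
  gcongr

variable [FiniteDimensional ℝ V] [MeasurableSpace V] [BorelSpace V]

/-- The transform of the $n$-th derivative is evaluated on $(\xi,\dots,\xi)$. This produces
$(2\pi)^n|\xi|^{2n}|\hat f(\xi)|$, while the operator norm costs $|\xi|^n$, which is cancelled;
hence the separate treatment of $\xi=0$. -/
theorem pow_mul_norm_fourier_le {f : V → ℂ} (hf : ContDiff ℝ ∞ f)
    (hfi : ∀ n, Integrable (iteratedFDeriv ℝ n f)) (n : ℕ) (ξ : V) :
    (2 * Real.pi * ‖ξ‖) ^ n * ‖𝓕 f ξ‖ ≤ ∫ v, ‖iteratedFDeriv ℝ n f v‖ := by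
  rcases eq_or_ne ξ 0 with rfl | hξ
  · rcases Nat.eq_zero_or_pos n with rfl | hn
    · simp only [pow_zero, one_mul, norm_iteratedFDeriv_zero]
      exact VectorFourier.norm_fourierIntegral_le_integral_norm _ _ _ _ _
    · rw [norm_zero, mul_zero, zero_pow hn.ne', zero_mul]
      exact integral_nonneg fun _ => norm_nonneg _
  have h1 : ‖𝓕 (iteratedFDeriv ℝ n f) ξ‖ ≤ ∫ v, ‖iteratedFDeriv ℝ n f v‖ :=
    VectorFourier.norm_fourierIntegral_le_integral_norm _ _ _ _ _
  refine le_trans ?_ h1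
  rw [Real.fourier_iteratedFDeriv (N := ⊤) hf (fun n _ => hfi n) le_top]
  have h2 := (VectorFourier.fourierPowSMulRight (-innerSL ℝ) (𝓕 f) ξ n).le_opNorm (fun _ => ξ)
  rw [VectorFourier.fourierPowSMulRight_apply] at h2
  have hpos : 0 < ‖ξ‖ ^ n := pow_pos (norm_pos_iff.2 hξ) n
  refine le_of_mul_le_mul_right ?_ hpos
  simp only [Finset.prod_const, Finset.card_univ, Fintype.card_fin] at h2
  refine le_trans (le_of_eq ?_) h2
  have h3 : ‖(-innerSL ℝ ξ) ξ‖ = ‖ξ‖ ^ 2 := by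
    simp
  have h4 : ‖(-(2 * (Real.pi : ℂ) * Complex.I))‖ = 2 * Real.pi := by
    simp [abs_of_pos Real.pi_pos]
  rw [norm_smul, norm_smul, norm_pow, norm_pow, h4, neg_apply, h3]
  ring

end Fourier

/-! ### Windows and the short-time Fourier transform -/

section Moderate

variable {V : Type*} [NormedAddCommGroup V]

/-- A weight function `w` which is moderate with respect to `W`. -/
structure IsModerate (w W : V → ℝ) : Prop where
  pos : ∀ x, 0 < w x
  pos' : ∀ x, 0 < W x
  neg : ∀ x, W (-x) = W x
  bddOn : ∃ C, 0 < C ∧ ∀ x, ‖x‖ ≤ 1 → W x ≤ C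
  le : ∀ x y, w (x + y) ≤ w x * W y

theorem IsModerate.le_mul_sub {w W : V → ℝ} (hw : IsModerate w W) (x t : V) :
    w x ≤ w t * W (t - x) := by
  have := hw.le t (x - t)
  rwa [add_sub_cancel, ← neg_sub, hw.neg] at this

/-- Going from $0$ to $x$ and back gives $w(0)\le w(x)W(x)\le w(0)W(x)^2$. -/
theorem IsModerate.one_le (hw : IsModerate w W) (x : V) : 1 ≤ W x := by
  have h1 := hw.le_mul_sub 0 x
  have h2 := hw.le 0 x
  rw [zero_add] at h2
  rw [sub_zero] at h1
  have h0 := hw.pos 0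
  have hW := hw.pos' x
  have h3 : w 0 * 1 ≤ w 0 * (W x * W x) := by
    calc w 0 * 1 ≤ w x * W x := by rw [mul_one]; exact h1
      _ ≤ w 0 * W x * W x := by gcongr
      _ = _ := by ring
  have h4 := le_of_mul_le_mul_left h3 h0
  nlinarith

end Moderate

section STFT

open scoped FourierTransform RealInnerProductSpace ComplexConjugate

variable {V : Type*} [NormedAddCommGroup V] [InnerProductSpace ℝ V]

/-- An integrable function of polynomial decay. -/
def polyDecay (s : V) : ℝ := ((1 + ‖s‖) ^ (Module.finrank ℝ V + 1))⁻¹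

theorem polyDecay_pos (s : V) : 0 < polyDecay s := by
  unfold polyDecay
  positivity

theorem polyDecay_le_of_dist_lt {s t : V} (h : dist s t < 1) :
    polyDecay s ≤ 2 ^ (Module.finrank ℝ V + 1) * polyDecay t := by
  unfold polyDecay
  rw [← div_eq_mul_inv, ← one_div, div_le_div_iff₀ (by positivity) (by positivity), one_mul,
    ← mul_pow]
  refine pow_le_pow_left₀ (by positivity) ?_ _
  have h1 : ‖t‖ ≤ ‖s‖ + dist s t := by
    rw [dist_comm, dist_eq_norm]
    calc ‖t‖ = ‖s + (t - s)‖ := by congr 1; abel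
      _ ≤ _ := norm_add_le _ _
  linarith [norm_nonneg s]

/-- A window: a smooth function whose derivatives are small with respect to `M` and decay rapidly
with respect to `W`. -/
structure IsWindow (M : ℕ → ℝ) (W : V → ℝ) (ψ : V → ℂ) : Prop where
  contDiff : ContDiff ℝ ∞ ψ
  bound : ∀ κ : ℝ, 0 < κ → ∃ C, 0 < C ∧ ∀ n s,
    ‖iteratedFDeriv ℝ n ψ s‖ * W s ≤ C * (κ ^ n * M n) * polyDecay s

/-- The short-time Fourier transform of `φ` with window `ψ`. -/
def stft [MeasurableSpace V] [BorelSpace V] [FiniteDimensional ℝ V] (ψ φ : V → ℂ) (z : V × V) : ℂ :=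
  𝓕 (fun t => φ t * conj (ψ (t - z.1))) z.2

/-- The synthesis operator associated with the window `ψ`. -/
def stftSynth [MeasurableSpace V] [BorelSpace V] [FiniteDimensional ℝ V] (ψ : V → ℂ)
    (G : V × V → ℂ) (t : V) : ℂ :=
  ∫ z : V × V, G z * (planeWave z.2 t * ψ (t - z.1))

variable {w W : V → ℝ} {M : ℕ → ℝ} {ψ φ : V → ℂ}

theorem contDiff_conj_sub (hψ : ContDiff ℝ ∞ ψ) (x : V) :
    ContDiff ℝ ∞ (fun t => conj (ψ (t - x))) :=
  Complex.conjCLE.contDiff.comp (hψ.comp (contDiff_id.sub contDiff_const))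

theorem norm_iteratedFDeriv_conj_sub (ψ : V → ℂ) (x t : V) (n : ℕ) :
    ‖iteratedFDeriv ℝ n (fun t => conj (ψ (t - x))) t‖ = ‖iteratedFDeriv ℝ n ψ (t - x)‖ := by
  have := Complex.conjLIE.norm_iteratedFDeriv_comp_left (fun t => ψ (t - x)) t n
  rw [iteratedFDeriv_comp_sub] at this
  exact this

/-- Leibniz' rule, with $w(x)\le w(t)W(t-x)$ moving the weight onto both factors. The constant
depends on $N$ only through $K$ and $l$, so one estimate serves both $M_nL^n$ and the sequences
built from $\mathfrak R$. -/
theorem IsWindow.exists_norm_iteratedFDeriv_mul_le (hψ : IsWindow M W ψ) (hw : IsModerate w W)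
    (hM : ∀ n, 0 < M n) {K l : ℝ} (hK : 0 < K) (hl : 0 < l) :
    ∃ C, 0 < C ∧ ∀ (N : ℕ → ℝ) (φ : V → ℂ) (B : ℝ), ContDiff ℝ ∞ φ → 0 ≤ B →
      (∀ n x, ‖iteratedFDeriv ℝ n φ x‖ * w x ≤ B * N n) →
      (∀ j m, N j * M m ≤ K * l ^ m * N (j + m)) → ∀ n x t,
      ‖iteratedFDeriv ℝ n (fun t => φ t * conj (ψ (t - x))) t‖ * w x ≤
        2 ^ n * (C * B * N n) * polyDecay (t - x) := by
  -- The choice $\kappa=l^{-1}$ cancels the factor $l^m$ from the compatibility of $N$ with $M$.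
  obtain ⟨C, hC, h⟩ := hψ.bound l⁻¹ (inv_pos.2 hl)
  refine ⟨C * K, by positivity, fun N φ B hφ hB hb hN n x t => ?_⟩
  have hmul := norm_iteratedFDeriv_mul_le (𝕜 := ℝ) (N := ∞) hφ (contDiff_conj_sub hψ.contDiff x) t
    (n := n) (by exact_mod_cast le_top)
  refine (mul_le_mul_of_nonneg_right hmul (hw.pos x).le).trans ?_
  rw [Finset.sum_mul]
  have hsum : (2 : ℝ) ^ n = ∑ i ∈ Finset.range (n + 1), (n.choose i : ℝ) := by
    exact_mod_cast (Nat.sum_range_choose n).symm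
  rw [hsum, Finset.sum_mul, Finset.sum_mul]
  refine Finset.sum_le_sum fun i hi => ?_
  have hin : i + (n - i) = n := by have := Finset.mem_range.1 hi; omega
  rw [norm_iteratedFDeriv_conj_sub]
  have hd := polyDecay_pos (t - x)
  have hwt := hw.pos t
  have hWt := hw.pos' (t - x)
  have hMm := hM (n - i)
  have hN' := hN i (n - i)
  rw [hin] at hN'
  have hBN : 0 ≤ B * N i := (mul_nonneg (norm_nonneg _) (hw.pos t).le).trans (hb i t)
  calc (n.choose i : ℝ) * ‖iteratedFDeriv ℝ i φ t‖ * ‖iteratedFDeriv ℝ (n - i) ψ (t - x)‖ * w x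
      ≤ (n.choose i : ℝ) * ‖iteratedFDeriv ℝ i φ t‖ * ‖iteratedFDeriv ℝ (n - i) ψ (t - x)‖ *
          (w t * W (t - x)) := by gcongr; exact hw.le_mul_sub x t
    _ = (n.choose i : ℝ) * ((‖iteratedFDeriv ℝ i φ t‖ * w t) *
          (‖iteratedFDeriv ℝ (n - i) ψ (t - x)‖ * W (t - x))) := by ring
    _ ≤ (n.choose i : ℝ) * ((B * N i) * (C * (l⁻¹ ^ (n - i) * M (n - i)) *
          polyDecay (t - x))) := by
        exact mul_le_mul_of_nonneg_left (mul_le_mul (hb i t) (h _ _) (by positivity) hBN)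
          (Nat.cast_nonneg _)
    _ = (n.choose i : ℝ) * (B * C * polyDecay (t - x) * l⁻¹ ^ (n - i) * (N i * M (n - i))) := by
        ring
    _ ≤ (n.choose i : ℝ) * (B * C * polyDecay (t - x) * l⁻¹ ^ (n - i) *
          (K * l ^ (n - i) * N n)) := by gcongr
    _ = _ := by
        rw [show (n.choose i : ℝ) * (B * C * polyDecay (t - x) * l⁻¹ ^ (n - i) *
          (K * l ^ (n - i) * N n)) = (n.choose i : ℝ) * (B * C * polyDecay (t - x) *
          (l⁻¹ ^ (n - i) * l ^ (n - i)) * K * N n) by ring, ← mul_pow, inv_mul_cancel₀ hl.ne',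
          one_pow]
        ring

theorem contDiff_windowed (hψ : ContDiff ℝ ∞ ψ) (hφ : ContDiff ℝ ∞ φ) (x : V) :
    ContDiff ℝ ∞ (fun t => φ t * conj (ψ (t - x))) :=
  hφ.mul (contDiff_conj_sub hψ x)

variable [FiniteDimensional ℝ V] [MeasurableSpace V] [BorelSpace V]

theorem integrable_polyDecay : Integrable (polyDecay : V → ℝ) := by
  have h := integrable_one_add_norm (E := V) (μ := volume) (r := (Module.finrank ℝ V + 1 : ℕ))
    (by push_cast; linarith)
  refine h.congr (Eventually.of_forall fun s => ?_)
  simp only [polyDecay]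
  rw [Real.rpow_neg (by positivity), Real.rpow_natCast]

theorem integrable_of_norm_mul_le {F : Type*} [NormedAddCommGroup F] {f : V → F}
    (hf : Continuous f) {a c : ℝ} (ha : 0 < a) (x : V)
    (h : ∀ t, ‖f t‖ * a ≤ c * polyDecay (t - x)) : Integrable f := by
  refine ((integrable_polyDecay.comp_sub_right x).const_mul (c / a)).mono'
    hf.aestronglyMeasurable (Eventually.of_forall fun t => ?_)
  rw [div_mul_eq_mul_div, le_div_iff₀ ha]
  exact h t

/-- Derivatives of the windowed function become powers of $2\pi|\xi|$. The $2^n$ of Leibniz' rule is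
paid by the factor $2$ there, which leaves $\pi|\xi|$. -/
theorem IsWindow.exists_stft_le (hψ : IsWindow M W ψ) (hw : IsModerate w W)
    (hM : ∀ n, 0 < M n) {K l : ℝ} (hK : 0 < K) (hl : 0 < l) :
    ∃ C, 0 < C ∧ ∀ (N : ℕ → ℝ) (φ : V → ℂ) (B : ℝ), ContDiff ℝ ∞ φ → 0 ≤ B →
      (∀ n x, ‖iteratedFDeriv ℝ n φ x‖ * w x ≤ B * N n) →
      (∀ j m, N j * M m ≤ K * l ^ m * N (j + m)) → ∀ n z,
      (Real.pi * ‖z.2‖) ^ n * ‖stft ψ φ z‖ * w z.1 ≤ C * B * N n := by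
  obtain ⟨C, hC, h⟩ := hψ.exists_norm_iteratedFDeriv_mul_le hw hM hK hl
  set I := ∫ s : V, polyDecay s with hI
  have hI0 : 0 ≤ I := integral_nonneg fun s => (polyDecay_pos s).le
  refine ⟨C * (I + 1), by positivity, fun N φ B hφ hB hb hN n z => ?_⟩
  have h' := fun n => h N φ B hφ hB hb hN n z.1
  have hsm := contDiff_windowed hψ.contDiff hφ z.1
  have hint : ∀ n, Integrable (iteratedFDeriv ℝ n (fun t => φ t * conj (ψ (t - z.1)))) := fun n =>
    integrable_of_norm_mul_le (hsm.continuous_iteratedFDeriv (by exact_mod_cast le_top))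
      (hw.pos z.1) z.1 (h' n)
  have h1 := pow_mul_norm_fourier_le hsm hint n z.2
  have h2 : (∫ t, ‖iteratedFDeriv ℝ n (fun t => φ t * conj (ψ (t - z.1))) t‖) * w z.1 ≤
      2 ^ n * (C * B * N n) * I := by
    rw [← integral_mul_const]
    calc _ ≤ ∫ t, 2 ^ n * (C * B * N n) * polyDecay (t - z.1) :=
          integral_mono ((hint n).norm.mul_const _)
            ((integrable_polyDecay.comp_sub_right z.1).const_mul _) (h' n)
      _ = _ := by rw [integral_const_mul, integral_sub_right_eq_self (fun s => polyDecay s)]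
  have h3 := (mul_le_mul_of_nonneg_right h1 (hw.pos z.1).le).trans h2
  have h4 : 0 ≤ B * N n := (mul_nonneg (norm_nonneg _) (hw.pos 0).le).trans (hb n 0)
  refine le_of_mul_le_mul_left ?_ (pow_pos two_pos n)
  calc (2 : ℝ) ^ n * ((Real.pi * ‖z.2‖) ^ n * ‖stft ψ φ z‖ * w z.1)
      = (2 * Real.pi * ‖z.2‖) ^ n * ‖stft ψ φ z‖ * w z.1 := by
        rw [mul_assoc 2 Real.pi, mul_pow 2]; ring
    _ ≤ 2 ^ n * (C * B * N n) * I := h3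
    _ = 2 ^ n * (C * (B * N n) * I) := by ring
    _ ≤ 2 ^ n * (C * (B * N n) * (I + 1)) := by gcongr; linarith
    _ = _ := by ring

theorem stronglyMeasurable_stft (hψ : Continuous ψ) (hφ : Continuous φ) :
    StronglyMeasurable (stft ψ φ) := by
  have : stft ψ φ = fun z : V × V => ∫ t, Complex.exp (((-2 * Real.pi * ⟪t, z.2⟫ : ℝ) : ℂ) *
      Complex.I) • (φ t * conj (ψ (t - z.1))) := by
    funext z
    exact Real.fourier_eq' _ _
  rw [this]
  refine StronglyMeasurable.integral_prod_right (f := fun (z : V × V) t =>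
    Complex.exp (((-2 * Real.pi * ⟪t, z.2⟫ : ℝ) : ℂ) * Complex.I) • (φ t * conj (ψ (t - z.1)))) ?_
  refine Continuous.stronglyMeasurable ?_
  simp only [Function.uncurry_def]
  fun_prop

end STFT

/-! ### Mapping properties of the synthesis operator -/

section Synthesis

open scoped FourierTransform RealInnerProductSpace ComplexConjugate

variable {V : Type*} [NormedAddCommGroup V] [InnerProductSpace ℝ V]
  {w W : V → ℝ} {M : ℕ → ℝ} {ψ φ : V → ℂ} {G : V × V → ℂ}

theorem contDiff_synthKernel (hψ : ContDiff ℝ ∞ ψ) :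
    ContDiff ℝ ∞ (Function.uncurry fun (z : V × V) (t : V) => planeWave z.2 t * ψ (t - z.1)) := by
  refine ContDiff.mul ?_ ?_
  · exact contDiff_planeWave.comp ((contDiff_snd.comp contDiff_fst).prodMk contDiff_snd)
  · exact hψ.comp (contDiff_snd.sub (contDiff_fst.comp contDiff_fst))

/-- Each power $|\xi|^i$ from the plane wave is at most $h^{-i}M_i$ times the growth function at
$h|\xi|$. Then $(M.1)$ merges $M_iM_{n-i}$ into $M_0M_n$, and the binomial sum is $(2\pi/h+1)^n$. -/
theorem IsWindow.exists_norm_iteratedFDeriv_synthKernel_le (hψ : IsWindow M W ψ)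
    (hW : ∀ x, 0 < W x) (hM : IsWeightSequence M) (hM1 : CondM1 M) :
    ∃ C, 0 < C ∧ ∀ h : ℝ, 0 < h → ∀ (n : ℕ) (z : V × V) (t : V),
      ‖iteratedFDeriv ℝ n (fun t => planeWave z.2 t * ψ (t - z.1)) t‖ * W (t - z.1) ≤
        C * growth M (h * ‖z.2‖) * (M n * (2 * Real.pi / h + 1) ^ n) * polyDecay (t - z.1) := by
  obtain ⟨C, hC, hb⟩ := hψ.bound 1 one_pos
  have hM0 := hM.1 0
  refine ⟨C * M 0, by positivity, fun h hh n ⟨x, ξ⟩ t => ?_⟩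
  simp only
  have hsm₁ : ContDiff ℝ ∞ (planeWave ξ) := contDiff_planeWave.comp (contDiff_const.prodMk contDiff_id)
  have hsm₂ : ContDiff ℝ ∞ (fun t => ψ (t - x)) := hψ.contDiff.comp (contDiff_id.sub contDiff_const)
  have hmul := norm_iteratedFDeriv_mul_le (𝕜 := ℝ) (N := ∞) hsm₁ hsm₂ t
    (n := n) (by exact_mod_cast le_top)
  have hWt := hW (t - x)
  have hd := polyDecay_pos (t - x)
  have hg := hM.growth_pos (h * ‖ξ‖)
  refine (mul_le_mul_of_nonneg_right hmul hWt.le).trans ?_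
  rw [Finset.sum_mul, add_pow, Finset.mul_sum, Finset.mul_sum, Finset.sum_mul]
  refine Finset.sum_le_sum fun i hi => ?_
  have hin : i + (n - i) = n := by have := Finset.mem_range.1 hi; omega
  rw [iteratedFDeriv_comp_sub]
  have h1 : ‖iteratedFDeriv ℝ i (planeWave ξ) t‖ ≤
      (2 * Real.pi / h) ^ i * (M i * growth M (h * ‖ξ‖)) := by
    refine (norm_iteratedFDeriv_planeWave_le ξ t i).trans ?_
    rw [show 2 * Real.pi * ‖ξ‖ = (2 * Real.pi / h) * (h * ‖ξ‖) by field_simp, mul_pow]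
    gcongr
    exact hM.pow_le_growth _ _
  have h2 := hb (n - i) (t - x)
  rw [one_pow, one_mul] at h2
  have h3 := hM.mul_le_of_condM1 hM1 i (n - i)
  rw [hin] at h3
  have hMi := hM.1 i
  calc (n.choose i : ℝ) * ‖iteratedFDeriv ℝ i (planeWave ξ) t‖ *
        ‖iteratedFDeriv ℝ (n - i) ψ (t - x)‖ * W (t - x)
      = (n.choose i : ℝ) * (‖iteratedFDeriv ℝ i (planeWave ξ) t‖ *
        (‖iteratedFDeriv ℝ (n - i) ψ (t - x)‖ * W (t - x))) := by ring
    _ ≤ (n.choose i : ℝ) * (((2 * Real.pi / h) ^ i * (M i * growth M (h * ‖ξ‖))) *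
        (C * M (n - i) * polyDecay (t - x))) := by
      refine mul_le_mul_of_nonneg_left (mul_le_mul h1 h2 (by positivity) (by positivity))
          (Nat.cast_nonneg _)
    _ = (n.choose i : ℝ) * ((2 * Real.pi / h) ^ i * growth M (h * ‖ξ‖) * C *
        polyDecay (t - x) * (M i * M (n - i))) := by ring
    _ ≤ (n.choose i : ℝ) * ((2 * Real.pi / h) ^ i * growth M (h * ‖ξ‖) * C *
        polyDecay (t - x) * (M 0 * M n)) := by gcongr
    _ = _ := by rw [one_pow]; ring

theorem exists_growth_le_polyDecay (V : Type*) [NormedAddCommGroup V] [InnerProductSpace ℝ V]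
    (hM : IsWeightSequence M) (hM2 : CondM2' M) {h : ℝ} (hh : 0 < h) :
    ∃ k C, 0 < k ∧ 0 < C ∧ ∀ ξ : V, growth M (k * ‖ξ‖) ≤
      C * growth M (h * ‖ξ‖) * polyDecay ξ := by
  obtain ⟨K, hK, hb⟩ := hM.exists_one_add_pow_mul_growth_le hM2 (Module.finrank ℝ V + 1)
  have hK0 : 0 < K := by linarith
  obtain ⟨C, hC, hb⟩ := hb (h / K) (by positivity)
  refine ⟨h / K, C, by positivity, hC, fun ξ => ?_⟩
  have := hb ‖ξ‖ (norm_nonneg _)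
  rw [mul_div_cancel₀ _ hK0.ne'] at this
  rw [polyDecay, ← div_eq_mul_inv, le_div_iff₀ (by positivity), mul_comm]
  exact this

/-- The basic pointwise estimate for the integrand of the synthesis operator. -/
theorem IsWindow.exists_synth_integrand_le (hψ : IsWindow M W ψ)
    (hw : IsModerate w W) (hM : IsWeightSequence M) (hM1 : CondM1 M) (hM2 : CondM2' M)
    {h : ℝ} (hh : 0 < h) :
    ∃ C L, 0 < C ∧ 0 < L ∧ ∀ (G : V × V → ℂ) (B : ℝ),
      (∀ z, ‖G z‖ * w z.1 * growth M (h * ‖z.2‖) ≤ B) → ∀ (n : ℕ) (z : V × V) (t : V),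
      ‖G z‖ * ‖iteratedFDeriv ℝ n (fun t => planeWave z.2 t * ψ (t - z.1)) t‖ * w t ≤
        C * B * (M n * L ^ n) * (polyDecay z.2 * polyDecay (t - z.1)) := by
  -- The kernel is estimated at the smaller frequency scale $k$; the gap between $k$ and $h$ leaves
  -- integrable decay in $\xi$.
  obtain ⟨k, C₁, hk, hC₁, h₁⟩ := exists_growth_le_polyDecay V hM hM2 hh
  obtain ⟨C₂, hC₂, h₂⟩ := hψ.exists_norm_iteratedFDeriv_synthKernel_le hw.pos' hM hM1
  refine ⟨C₁ * C₂, 2 * Real.pi / k + 1, by positivity, by positivity, fun G B hG n z t => ?_⟩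
  have h₂ := h₂ k hk n z t
  have h₁ := h₁ z.2
  have hG := hG z
  have hd := polyDecay_pos (t - z.1)
  have hd' := polyDecay_pos z.2
  have hwz := hw.pos z.1
  have hMn := hM.1 n
  set D := ‖iteratedFDeriv ℝ n (fun t => planeWave z.2 t * ψ (t - z.1)) t‖ with hD
  have hD0 : 0 ≤ D := norm_nonneg _
  have hwt : w t ≤ w z.1 * W (t - z.1) := by
    have := hw.le z.1 (t - z.1)
    rwa [add_sub_cancel] at this
  set Q := M n * (2 * Real.pi / k + 1) ^ n with hQ
  have hQ0 : 0 < Q := by positivity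
  calc ‖G z‖ * D * w t ≤ ‖G z‖ * D * (w z.1 * W (t - z.1)) := by gcongr
    _ = ‖G z‖ * w z.1 * (D * W (t - z.1)) := by ring
    _ ≤ ‖G z‖ * w z.1 * (C₂ * growth M (k * ‖z.2‖) * Q * polyDecay (t - z.1)) := by gcongr
    _ ≤ ‖G z‖ * w z.1 * (C₂ * (C₁ * growth M (h * ‖z.2‖) * polyDecay z.2) * Q *
          polyDecay (t - z.1)) := by gcongr
    _ = (‖G z‖ * w z.1 * growth M (h * ‖z.2‖)) * (C₁ * C₂ * Q * (polyDecay z.2 *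
          polyDecay (t - z.1))) := by ring
    _ ≤ B * (C₁ * C₂ * Q * (polyDecay z.2 * polyDecay (t - z.1))) := by gcongr
    _ = _ := by ring

theorem iteratedFDeriv_synth_integrand (hψ : ContDiff ℝ ∞ ψ) (n : ℕ) (z : V × V) (t : V) :
    iteratedFDeriv ℝ n (fun t => G z * (planeWave z.2 t * ψ (t - z.1))) t =
      G z • iteratedFDeriv ℝ n (fun t => planeWave z.2 t * ψ (t - z.1)) t := by
  have hsm : ContDiff ℝ ∞ (fun t => planeWave z.2 t * ψ (t - z.1)) :=
    (contDiff_synthKernel hψ).comp (contDiff_const.prodMk contDiff_id)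
  exact iteratedFDeriv_const_smul_apply (𝕜 := ℝ) (a := G z) (hsm.contDiffAt.of_le (by exact_mod_cast le_top))

variable [FiniteDimensional ℝ V] [MeasurableSpace V] [BorelSpace V]

theorem integrable_polyDecay_mul (t : V) :
    Integrable (fun z : V × V => polyDecay z.2 * polyDecay (t - z.1)) := by
  have := (integrable_polyDecay.comp_sub_left t).mul_prod (integrable_polyDecay (V := V))
  rw [Measure.volume_eq_prod]
  simpa only [mul_comm] using this

theorem integral_polyDecay_mul (t : V) :
    ∫ z : V × V, polyDecay z.2 * polyDecay (t - z.1) = (∫ s : V, polyDecay s) ^ 2 := by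
  have := integral_prod_mul (μ := volume) (ν := volume) (fun x : V => polyDecay (t - x))
    (fun ξ : V => polyDecay ξ)
  rw [integral_sub_left_eq_self (fun s => polyDecay s)] at this
  rw [sq, ← this]
  simp only [mul_comm]
  rfl

theorem aestronglyMeasurable_synth_integrand (hψ : ContDiff ℝ ∞ ψ)
    (hG : AEStronglyMeasurable G) (n : ℕ) (t : V) :
    AEStronglyMeasurable (fun z : V × V => G z •
      iteratedFDeriv ℝ n (fun t => planeWave z.2 t * ψ (t - z.1)) t) := by
  refine hG.smul ?_
  have := (contDiff_iteratedFDeriv_uncurry (contDiff_synthKernel hψ) n).continuous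
  exact (this.comp (continuous_id.prodMk continuous_const)).aestronglyMeasurable

/-- The functions to which the synthesis operator is applied. -/
structure IsSynthesizable (M : ℕ → ℝ) (w : V → ℝ) (h B : ℝ) (G : V × V → ℂ) : Prop where
  aesm : AEStronglyMeasurable G
  bound : ∀ z, ‖G z‖ * w z.1 * growth M (h * ‖z.2‖) ≤ B

theorem IsSynthesizable.indicator {h B : ℝ} (hG : IsSynthesizable M w h B G) (hB : 0 ≤ B)
    {S : Set (V × V)} (hS : MeasurableSet S) : IsSynthesizable M w h B (S.indicator G) := by
  refine ⟨hG.aesm.indicator hS, fun z => ?_⟩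
  by_cases hz : z ∈ S
  · rw [Set.indicator_of_mem hz]; exact hG.bound z
  · rw [Set.indicator_of_notMem hz]; simpa using hB

/-- The integrand and all its derivatives are dominated by products of integrable functions of $x$
and $\xi$, so differentiation under the integral applies. Since $L$ depends on $h$ but not on $G$, a
whole scale lands in one step of the inductive limit. -/
theorem IsWindow.exists_stftSynth (hψ : IsWindow M W ψ)
    (hw : IsModerate w W) (hM : IsWeightSequence M) (hM1 : CondM1 M) (hM2 : CondM2' M)
    {h : ℝ} (hh : 0 < h) :
    ∃ C L, 0 < C ∧ 0 < L ∧ ∀ (G : V × V → ℂ) (B : ℝ), IsSynthesizable M w h B G →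
      (∀ t, Integrable fun z : V × V => G z * (planeWave z.2 t * ψ (t - z.1))) ∧
      ContDiff ℝ ∞ (stftSynth ψ G) ∧
      ∀ n t, ‖iteratedFDeriv ℝ n (stftSynth ψ G) t‖ * w t ≤ C * B * (M n * L ^ n) := by
  obtain ⟨C, L, hC, hL, hb⟩ := hψ.exists_synth_integrand_le hw hM hM1 hM2 hh
  set I := ∫ s : V, polyDecay s with hI
  refine ⟨C * (I ^ 2 + 1), L, by positivity, hL, fun G B ⟨hG, hGB⟩ => ?_⟩
  have hb := hb G B hGB
  have hB : 0 ≤ B := by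
    refine le_trans ?_ (hGB 0)
    have := hw.pos (0 : V × V).1
    have := hM.growth_pos (h * ‖(0 : V × V).2‖)
    positivity
  have hb' : ∀ n t z, ‖G z • iteratedFDeriv ℝ n (fun t => planeWave z.2 t * ψ (t - z.1)) t‖ ≤
      C * B * (M n * L ^ n) / w t * (polyDecay z.2 * polyDecay (t - z.1)) := by
    intro n t z
    rw [norm_smul, div_mul_eq_mul_div, le_div_iff₀ (hw.pos t)]
    exact hb n z t
  have hmeas := fun n t => aestronglyMeasurable_synth_integrand hψ.contDiff hG n t
  have hint : ∀ n t, Integrable fun z : V × V =>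
      G z • iteratedFDeriv ℝ n (fun t => planeWave z.2 t * ψ (t - z.1)) t := fun n t =>
    ((integrable_polyDecay_mul t).const_mul _).mono' (hmeas n t) (Eventually.of_forall (hb' n t))
  set K : V × V → V → ℂ := fun z t => G z * (planeWave z.2 t * ψ (t - z.1)) with hK
  have hKn : ∀ n t z, iteratedFDeriv ℝ n (K z) t =
      G z • iteratedFDeriv ℝ n (fun t => planeWave z.2 t * ψ (t - z.1)) t := fun n t z =>
    iteratedFDeriv_synth_integrand hψ.contDiff n z t
  have hKs : ∀ z, ContDiff ℝ ∞ (K z) := fun z =>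
    contDiff_const.mul ((contDiff_synthKernel hψ.contDiff).comp (contDiff_const.prodMk contDiff_id))
  have hKm : ∀ n t, AEStronglyMeasurable (fun z => iteratedFDeriv ℝ n (K z) t) := fun n t => by
    simp only [hKn]; exact hmeas n t
  obtain ⟨c, hc, hWc⟩ := hw.bddOn
  have hKb : ∀ (n : ℕ) (t₀ : V), ∃ bound : V × V → ℝ, Integrable bound ∧
      ∀ z, ∀ t ∈ Metric.ball t₀ 1, ‖iteratedFDeriv ℝ n (K z) t‖ ≤ bound z := by
    intro n t₀
    -- Moving $t$ inside the unit ball about $t_0$ costs $c$ in the weight and $2^{\dim V+1}$ in the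
    -- polynomial decay.
    refine ⟨fun z => C * B * (M n * L ^ n) * c / w t₀ * 2 ^ (Module.finrank ℝ V + 1) *
      (polyDecay z.2 * polyDecay (t₀ - z.1)), (integrable_polyDecay_mul t₀).const_mul _,
      fun z t ht => ?_⟩
    rw [hKn]
    refine (hb' n t z).trans ?_
    have hwt := hw.pos t
    have hwt₀ := hw.pos t₀
    have hMn := hM.1 n
    have h1 : w t₀ ≤ w t * c := by
      refine (hw.le_mul_sub t₀ t).trans ?_
      gcongr
      refine hWc _ ?_
      rw [← dist_eq_norm]
      exact (Metric.mem_ball.1 ht).le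
    have h2 : polyDecay (t - z.1) ≤ 2 ^ (Module.finrank ℝ V + 1) * polyDecay (t₀ - z.1) :=
      polyDecay_le_of_dist_lt (by rw [dist_sub_right]; exact Metric.mem_ball.1 ht)
    have h3 : C * B * (M n * L ^ n) / w t ≤ C * B * (M n * L ^ n) * c / w t₀ := by
      rw [div_le_div_iff₀ hwt hwt₀, mul_assoc _ c, mul_comm c]
      gcongr
    have hd' := polyDecay_pos z.2
    have hd := polyDecay_pos (t - z.1)
    calc _ ≤ C * B * (M n * L ^ n) * c / w t₀ * (polyDecay z.2 *
          (2 ^ (Module.finrank ℝ V + 1) * polyDecay (t₀ - z.1))) := by gcongr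
      _ = _ := by ring
  refine ⟨fun t => ?_, contDiff_integral hKs hKm hKb, fun n t => ?_⟩
  · have h1 := hint 0 t
    refine h1.norm.mono' ?_ (Eventually.of_forall fun z => ?_)
    · refine hG.mul (Continuous.aestronglyMeasurable ?_)
      exact (contDiff_synthKernel hψ.contDiff).continuous.comp
        (continuous_id.prodMk continuous_const)
    · rw [norm_smul, norm_iteratedFDeriv_zero, norm_mul]
  · have h1 : iteratedFDeriv ℝ n (stftSynth ψ G) t = ∫ z, G z •
        iteratedFDeriv ℝ n (fun t => planeWave z.2 t * ψ (t - z.1)) t := by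
      have := congrFun (iteratedFDeriv_integral hKs hKm hKb n) t
      simp only [hKn] at this
      exact this
    rw [h1]
    have h2 := norm_integral_le_of_norm_le ((integrable_polyDecay_mul t).const_mul
      (C * B * (M n * L ^ n) / w t)) (Eventually.of_forall (hb' n t))
    rw [integral_const_mul, integral_polyDecay_mul, ← hI, div_mul_eq_mul_div,
      le_div_iff₀ (hw.pos t)] at h2
    refine h2.trans ?_
    have hMn := hM.1 n
    calc C * B * (M n * L ^ n) * I ^ 2 ≤ C * B * (M n * L ^ n) * (I ^ 2 + 1) := by gcongr; linarith
      _ = _ := by ring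

end Synthesis

/-! ### Inversion of the short-time Fourier transform -/

section Reconstruction

open scoped FourierTransform RealInnerProductSpace ComplexConjugate

variable {V : Type*} [NormedAddCommGroup V] [InnerProductSpace ℝ V]
  [FiniteDimensional ℝ V] [MeasurableSpace V] [BorelSpace V]
  {w W : V → ℝ} {M : ℕ → ℝ} {ψ φ : V → ℂ}

/-- The transform estimate for $N_n=M_nL^n$ holds for all $n$ simultaneously; the supremum over $n$
is the growth function at $\pi|\xi|/L$. -/
theorem IsWindow.exists_isSynthesizable_stft (hψ : IsWindow M W ψ) (hw : IsModerate w W)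
    (hM : IsWeightSequence M) (hM1 : CondM1 M) {L : ℝ} (hL : 0 < L) :
    ∃ C, 0 < C ∧ ∀ (φ : V → ℂ) (B : ℝ), ContDiff ℝ ∞ φ → 0 ≤ B →
      (∀ n x, ‖iteratedFDeriv ℝ n φ x‖ * w x ≤ B * (M n * L ^ n)) →
      IsSynthesizable M w (Real.pi / L) (C * B) (stft ψ φ) := by
  obtain ⟨C, hC, h⟩ := hψ.exists_stft_le hw hM.1 (hM.1 0) (inv_pos.2 hL)
  refine ⟨C, hC, fun φ B hφ hB hb => ⟨?_, fun z => ?_⟩⟩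
  · exact (stronglyMeasurable_stft hψ.contDiff.continuous hφ.continuous).aestronglyMeasurable
  · have h1 := h _ φ B hφ hB hb (fun j m => by
      have := hM.mul_le_of_condM1 hM1 j m
      calc M j * L ^ j * M m = L ^ j * (M j * M m) := by ring
        _ ≤ L ^ j * (M 0 * M (j + m)) := by gcongr
        _ = M 0 * (L⁻¹ ^ m * L ^ m) * (M (j + m) * L ^ j) := by
          rw [← mul_pow, inv_mul_cancel₀ hL.ne', one_pow]; ring
        _ = _ := by rw [pow_add]; ring)
    have hVw : 0 ≤ ‖stft ψ φ z‖ * w z.1 := mul_nonneg (norm_nonneg _) (hw.pos _).le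
    rw [growth, Real.mul_iSup_of_nonneg hVw]
    refine ciSup_le fun n => ?_
    have h2 := h1 n z
    have hMn := hM.1 n
    rw [← mul_div_assoc, div_le_iff₀ hMn]
    refine le_of_mul_le_mul_right ?_ (pow_pos hL n)
    calc ‖stft ψ φ z‖ * w z.1 * (Real.pi / L * ‖z.2‖) ^ n * L ^ n
        = ‖stft ψ φ z‖ * w z.1 * (Real.pi * ‖z.2‖) ^ n := by
          rw [mul_assoc _ _ (L ^ n), ← mul_pow]
          congr 2
          field_simp
      _ ≤ C * B * (M n * L ^ n) := by linarith
      _ = _ := by ring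

theorem IsSynthesizable.exists_norm_le {G : V × V → ℂ} {h B : ℝ} (hG : IsSynthesizable M w h B G)
    (hw : ∀ x, 0 < w x) (hM : IsWeightSequence M) (hM2 : CondM2' M) (hh : 0 < h) (x : V) :
    ∃ c, ∀ ξ, ‖G (x, ξ)‖ ≤ c * polyDecay ξ := by
  obtain ⟨k, C, hk, hC, h₁⟩ := exists_growth_le_polyDecay V hM hM2 hh
  refine ⟨B * C * M 0 / w x, fun ξ => ?_⟩
  rw [div_mul_eq_mul_div, le_div_iff₀ (hw x)]
  have h2 := hG.bound (x, ξ)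
  simp only at h2
  have hM0 := hM.1 0
  have h3 : 1 ≤ M 0 * growth M (k * ‖ξ‖) := by simpa using hM.pow_le_growth (k * ‖ξ‖) 0
  have hwx := hw x
  have hd := polyDecay_pos ξ
  calc ‖G (x, ξ)‖ * w x = ‖G (x, ξ)‖ * w x * 1 := (mul_one _).symm
    _ ≤ ‖G (x, ξ)‖ * w x * (M 0 * (C * growth M (h * ‖ξ‖) * polyDecay ξ)) := by
      gcongr
      exact h3.trans (by gcongr; exact h₁ ξ)
    _ = (‖G (x, ξ)‖ * w x * growth M (h * ‖ξ‖)) * (M 0 * C * polyDecay ξ) := by ring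
    _ ≤ B * (M 0 * C * polyDecay ξ) := by gcongr
    _ = _ := by ring

/-- By Fubini, the integral over $\xi$ at fixed $x$ is a Fourier inversion and yields
$\varphi(t)|\psi(t-x)|^2$; integrating over $x$ leaves $\|\psi\|_2^2\,\varphi(t)$. -/
theorem stftSynth_stft (hψ : ContDiff ℝ ∞ ψ) (hφ : ContDiff ℝ ∞ φ)
    (hint : ∀ x, Integrable (fun t => φ t * conj (ψ (t - x))))
    (hF : ∀ x, Integrable (fun ξ => stft ψ φ (x, ξ))) (t : V)
    (hI : Integrable fun z : V × V => stft ψ φ z * (planeWave z.2 t * ψ (t - z.1))) :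
    stftSynth ψ (stft ψ φ) t = (∫ s, conj (ψ s) * ψ s) * φ t := by
  have hinner : ∀ x, ∫ ξ, stft ψ φ (x, ξ) * (planeWave ξ t * ψ (t - x)) =
      φ t * (conj (ψ (t - x)) * ψ (t - x)) := by
    intro x
    have h1 := congrFun ((contDiff_windowed hψ hφ x).continuous.fourierInv_fourier_eq (hint x) (hF x)) t
    rw [Real.fourierInv_eq'] at h1
    rw [← mul_assoc, ← h1, ← integral_mul_const]
    refine integral_congr_ae (Eventually.of_forall fun ξ => ?_)
    simp only [stft, planeWave, smul_eq_mul]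
    ring
  rw [stftSynth]
  rw [Measure.volume_eq_prod] at hI ⊢
  rw [integral_prod _ hI]
  simp only [hinner]
  rw [integral_const_mul, integral_sub_left_eq_self (fun s => conj (ψ s) * ψ s), mul_comm]

theorem IsWindow.integral_ne_zero (hψ : IsWindow M W ψ) (hW : ∀ x, 1 ≤ W x) (h0 : ψ ≠ 0) :
    (∫ s, conj (ψ s) * ψ s) ≠ 0 := by
  obtain ⟨x, hx⟩ := Function.ne_iff.1 h0
  have h1 : ∀ s, conj (ψ s) * ψ s = ((‖ψ s‖ ^ 2 : ℝ) : ℂ) := fun s => by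
    rw [mul_comm, Complex.mul_conj, Complex.normSq_eq_norm_sq]
  simp only [h1]
  rw [integral_complex_ofReal, Complex.ofReal_ne_zero]
  obtain ⟨C, hC, hb⟩ := hψ.bound 1 one_pos
  have hb' : ∀ s, ‖ψ s‖ ≤ C * M 0 * polyDecay s := fun s => by
    have := hb 0 s
    rw [norm_iteratedFDeriv_zero] at this
    refine (le_mul_of_one_le_right (norm_nonneg _) (hW s)).trans ?_
    simpa using this
  have hcont : Continuous fun s => ‖ψ s‖ ^ 2 := hψ.contDiff.continuous.norm.pow 2
  have hd1 : ∀ s : V, polyDecay s ≤ 1 := fun s => by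
    unfold polyDecay
    exact inv_le_one_of_one_le₀ (one_le_pow₀ (by linarith [norm_nonneg s]))
  have hint : Integrable fun s => ‖ψ s‖ ^ 2 := by
    refine (integrable_polyDecay.const_mul ((C * M 0) ^ 2)).mono' hcont.aestronglyMeasurable
      (Eventually.of_forall fun s => ?_)
    rw [Real.norm_of_nonneg (by positivity)]
    have hd := polyDecay_pos s
    calc ‖ψ s‖ ^ 2 ≤ (C * M 0 * polyDecay s) ^ 2 := pow_le_pow_left₀ (norm_nonneg _) (hb' s) 2
      _ = (C * M 0) ^ 2 * (polyDecay s * polyDecay s) := by ring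
      _ ≤ (C * M 0) ^ 2 * (polyDecay s * 1) := by gcongr; exact hd1 s
      _ = _ := by ring
  exact (integral_pos_of_integrable_nonneg_nonzero hcont hint (fun s => by positivity)
    (x := x) (by simpa using hx)).ne'

end Reconstruction

/-! ### Splitting into frequency shells -/

section Shells

variable {V : Type*} [NormedAddCommGroup V] [InnerProductSpace ℝ V]
  [FiniteDimensional ℝ V] [MeasurableSpace V] [BorelSpace V]
  {w : V → ℝ} {M : ℕ → ℝ}

/-- $Q_k$ will be the constant of the seminorm at scale $h_k$. Starting the $k$-th shell far enough
out, doubling the scale beats $Q_k$ with $2^{-k}$ to spare. The shell $k=0$ starts at the origin,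
where no smallness is available; it forces the factor $Q_0+1$. -/
theorem exists_shells (hM : IsWeightSequence M) (h Q : ℕ → ℝ) (hh : ∀ k, 0 < h k)
    (hQ : ∀ k, 0 < Q k) :
    ∃ R : ℕ → ℝ, R 0 = 0 ∧ Monotone R ∧ Tendsto R atTop atTop ∧ ∀ k t, R k ≤ t →
      Q k * growth M (h k * t) ≤ (Q 0 + 1) * (1 / 2) ^ k * growth M (2 * (h k * t)) := by
  have h1 : ∀ k, ∃ ρ : ℝ, 0 < ρ ∧ ∀ t, ρ ≤ t →
      growth M t ≤ (1 / 2) ^ k / Q k * growth M (2 * t) := fun k =>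
    hM.exists_growth_le_mul (div_pos (by positivity) (hQ k))
  choose ρ hρ hgr using h1
  -- The radii are partial sums of these increments; the added $1$ makes them tend to infinity.
  set a : ℕ → ℝ := fun i => ρ (i + 1) / h (i + 1) + 1 with ha
  have ha1 : ∀ i, 1 ≤ a i := fun i => by
    have := div_pos (hρ (i + 1)) (hh (i + 1))
    simp only [ha]; linarith
  have hmono : Monotone fun k => ∑ i ∈ Finset.range k, a i := by
    refine monotone_nat_of_le_succ fun k => ?_
    rw [Finset.sum_range_succ]
    linarith [ha1 k]
  refine ⟨fun k => ∑ i ∈ Finset.range k, a i, by simp, hmono, ?_, ?_⟩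
  · refine tendsto_atTop_mono (fun k => ?_) tendsto_natCast_atTop_atTop
    calc (k : ℝ) = ∑ _i ∈ Finset.range k, (1 : ℝ) := by simp
      _ ≤ _ := Finset.sum_le_sum fun i _ => ha1 i
  · rintro (_ | k) t ht
    · simp only [Finset.range_zero, Finset.sum_empty] at ht
      have h2 : growth M (h 0 * t) ≤ growth M (2 * (h 0 * t)) :=
        hM.growth_mono (mul_nonneg (hh 0).le ht) (by nlinarith [hh 0])
      have := hQ 0
      have hg := hM.growth_pos (2 * (h 0 * t))
      calc _ ≤ Q 0 * growth M (2 * (h 0 * t)) := by gcongr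
        _ ≤ (Q 0 + 1) * (1 / 2) ^ 0 * growth M (2 * (h 0 * t)) := by
          rw [pow_zero, mul_one]; gcongr; linarith
    · have h2 : ρ (k + 1) ≤ h (k + 1) * t := by
        have h3 : a k ≤ ∑ i ∈ Finset.range (k + 1), a i :=
          Finset.single_le_sum (fun i _ => by linarith [ha1 i]) (Finset.self_mem_range_succ k)
        have h4 : ρ (k + 1) / h (k + 1) ≤ t := by
          simp only [ha] at h3 ht ⊢; linarith
        rwa [div_le_iff₀' (hh _)] at h4
      have h5 := hgr (k + 1) _ h2
      have hQk := hQ (k + 1)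
      have hQ0 := hQ 0
      have hg := hM.growth_pos (2 * (h (k + 1) * t))
      calc Q (k + 1) * growth M (h (k + 1) * t)
          ≤ Q (k + 1) * ((1 / 2) ^ (k + 1) / Q (k + 1) * growth M (2 * (h (k + 1) * t))) := by
            gcongr
        _ = 1 * (1 / 2) ^ (k + 1) * growth M (2 * (h (k + 1) * t)) := by
            field_simp
        _ ≤ _ := by gcongr; linarith

/-- A subadditive function on the synthesizable functions that is bounded on each step is bounded by
a norm attached to a sequence of the Komatsu family. -/
theorem exists_komatsuFamily_le (hM : IsWeightSequence M) (hw : ∀ x, 0 < w x) {D : ℝ} (hD : 0 < D)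
    (q : (V × V → ℂ) → ℝ)
    (hq : ∀ h, 0 < h → ∃ Q, 0 < Q ∧ ∀ G B, IsSynthesizable M w h B G → q G ≤ Q * B)
    (hadd : ∀ h B G S, 0 < h → IsSynthesizable M w h B G → MeasurableSet S →
      q G ≤ q (S.indicator G) + q (Sᶜ.indicator G)) :
    ∃ r ∈ KomatsuFamily, ∃ C, 0 < C ∧ ∀ (G : V × V → ℂ) (B : ℝ),
      (∃ h B', 0 < h ∧ IsSynthesizable M w h B' G) →
      (∀ n z, (Real.pi * ‖z.2‖) ^ n * ‖G z‖ * w z.1 ≤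
        B * (D ^ n * (M n * ∏ j ∈ Finset.range (n + 1), r j))) → q G ≤ C * B := by
  -- Chosen so that $2h_k|\xi|\cdot D(k+1)=\pi|\xi|$: where $\prod_{j\le n} r_j\le(k+1)^n$, the
  -- assumed bound on $G$ is exactly a bound at scale $2h_k$.
  set h : ℕ → ℝ := fun k => Real.pi / (D * (2 * ((k : ℝ) + 1))) with hh
  have hhpos : ∀ k, 0 < h k := fun k => by simp only [hh]; positivity
  choose Q hQ hqQ using fun k => hq (h k) (hhpos k)
  obtain ⟨R, hR0, hRm, hRt, hR⟩ := exists_shells hM h Q hhpos hQ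
  have hM0 := hM.1 0
  have hRnn : ∀ k, 0 ≤ R k := fun k => hR0 ▸ hRm (Nat.zero_le k)
  -- On the $k$-th shell $|\xi|\le R_{k+1}$, so orders beyond $b_k$ are no worse than order zero.
  -- Only the orders $n\le b_k$ constrain $r$.
  have hb : ∀ k, ∃ b : ℕ, ∀ n, b ≤ n → (2 * h k * R (k + 1)) ^ n / M n ≤ 1 / M 0 := fun k =>
    eventually_atTop.1 ((hM.tendsto_pow_div _).eventually_le_const (by positivity))
  choose b hb using hb
  obtain ⟨r, hr, hrb⟩ := exists_komatsuFamily_prod_le b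
  refine ⟨r, hr, 2 * (Q 0 + 1), by have := hQ 0; positivity, fun G B hG hGB => ?_⟩
  obtain ⟨h', B', hh', hG'⟩ := hG
  set T : ℕ → Set (V × V) := fun k => {z | R k ≤ ‖z.2‖} with hT
  have hTm : ∀ k, MeasurableSet (T k) := fun k =>
    measurableSet_le measurable_const measurable_snd.norm
  have hTanti : ∀ k, T (k + 1) ⊆ T k := fun k z hz => (hRm (Nat.le_succ k)).trans hz
  have hB' : 0 ≤ B' := by
    refine le_trans ?_ (hG'.bound 0)
    have := hw (0 : V × V).1
    have := hM.growth_pos (h' * ‖(0 : V × V).2‖)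
    positivity
  -- the bound on the shells
  have hr0 : r 0 ≤ 1 := by simpa using hrb 0 0 (Nat.zero_le _)
  have hB : 0 ≤ B := by
    have h1 := hGB 0 0
    have h2 : 0 < D ^ 0 * (M 0 * ∏ j ∈ Finset.range (0 + 1), r j) := by
      have := hr.1 0
      simpa using mul_pos hM0 this
    have h3 : 0 ≤ (Real.pi * ‖(0 : V × V).2‖) ^ 0 * ‖G 0‖ * w (0 : V × V).1 := by
      have := hw (0 : V × V).1
      positivity
    exact nonneg_of_mul_nonneg_left (h3.trans h1) h2
  have hzero : ∀ z, ‖G z‖ * w z.1 ≤ B * M 0 := fun z => by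
    have := hGB 0 z
    simp only [pow_zero, one_mul, zero_add, Finset.range_one, Finset.prod_singleton] at this
    refine this.trans ?_
    gcongr
    exact mul_le_of_le_one_right hM0.le hr0
  have hshell : ∀ k z, z ∈ T k → z ∉ T (k + 1) →
      ‖G z‖ * w z.1 * growth M (2 * (h k * ‖z.2‖)) ≤ B := by
    intro k z hz hz'
    have hlt : ‖z.2‖ ≤ R (k + 1) := (not_le.1 hz').le
    have hGw : 0 ≤ ‖G z‖ * w z.1 := mul_nonneg (norm_nonneg _) (hw _).le
    have hhk := hhpos k
    rw [growth, Real.mul_iSup_of_nonneg hGw]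
    refine ciSup_le fun n => ?_
    have hMn := hM.1 n
    rcases le_total n (b k) with hn | hn
    · have h1 := hrb k n hn
      have h2 := hGB n z
      rw [← mul_div_assoc, div_le_iff₀ hMn]
      have hDk : 0 < (D * ((k : ℝ) + 1)) ^ n := by positivity
      refine le_of_mul_le_mul_right ?_ hDk
      calc ‖G z‖ * w z.1 * (2 * (h k * ‖z.2‖)) ^ n * (D * ((k : ℝ) + 1)) ^ n
          = (Real.pi * ‖z.2‖) ^ n * ‖G z‖ * w z.1 := by
            rw [mul_assoc _ _ ((D * ((k : ℝ) + 1)) ^ n), ← mul_pow,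
              show 2 * (h k * ‖z.2‖) * (D * ((k : ℝ) + 1)) = Real.pi * ‖z.2‖ by
                simp only [hh]; field_simp]
            ring
        _ ≤ B * (D ^ n * (M n * ((k : ℝ) + 1) ^ n)) := h2.trans (by gcongr)
        _ = B * M n * (D * ((k : ℝ) + 1)) ^ n := by rw [mul_pow]; ring
    · have h1 := hb k n hn
      have h2 : (2 * (h k * ‖z.2‖)) ^ n / M n ≤ 1 / M 0 := by
        refine le_trans ?_ h1
        rw [← mul_assoc]
        gcongr
      calc ‖G z‖ * w z.1 * ((2 * (h k * ‖z.2‖)) ^ n / M n) ≤ B * M 0 * (1 / M 0) := by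
            have := (hRnn k).trans hz
            exact mul_le_mul (hzero z) h2 (by positivity) (by positivity)
        _ = B := by field_simp
  have hstep : ∀ k, q ((T k).indicator G) ≤
      q ((T (k + 1)).indicator G) + (Q 0 + 1) * (1 / 2) ^ k * B := by
    intro k
    have h1 := hadd h' B' ((T k).indicator G) (T (k + 1)) hh' (hG'.indicator hB' (hTm k))
      (hTm (k + 1))
    rw [Set.indicator_indicator, Set.indicator_indicator,
      Set.inter_eq_left.2 (hTanti k)] at h1
    refine h1.trans (add_le_add le_rfl ?_)
    -- The shell piece is bounded by $B$ at scale $2h_k$; dropping to $h_k$ gains $2^{-k}/Q_k$,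
    -- which cancels the constant $Q_k$ of $q$.
    have h2 : IsSynthesizable M w (h k) ((Q 0 + 1) * (1 / 2) ^ k / Q k * B)
        (((T (k + 1))ᶜ ∩ T k).indicator G) := by
      refine ⟨hG'.aesm.indicator ((hTm _).compl.inter (hTm k)), fun z => ?_⟩
      have hQk := hQ k
      have hQ0 := hQ 0
      by_cases hz : z ∈ (T (k + 1))ᶜ ∩ T k
      · rw [Set.indicator_of_mem hz]
        have h3 := hshell k z hz.2 hz.1
        have h4 := hR k ‖z.2‖ hz.2
        have hGw : 0 ≤ ‖G z‖ * w z.1 := mul_nonneg (norm_nonneg _) (hw _).le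
        have h5 : growth M (h k * ‖z.2‖) ≤
            (Q 0 + 1) * (1 / 2) ^ k / Q k * growth M (2 * (h k * ‖z.2‖)) := by
          rw [div_mul_eq_mul_div ((Q 0 + 1) * (1 / 2) ^ k), le_div_iff₀ hQk, mul_comm]
          exact h4
        calc _ ≤ ‖G z‖ * w z.1 * ((Q 0 + 1) * (1 / 2) ^ k / Q k *
              growth M (2 * (h k * ‖z.2‖))) := by gcongr
          _ = (Q 0 + 1) * (1 / 2) ^ k / Q k * (‖G z‖ * w z.1 *
              growth M (2 * (h k * ‖z.2‖))) := by ring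
          _ ≤ _ := by gcongr
      · rw [Set.indicator_of_notMem hz]
        simp only [norm_zero, zero_mul]
        positivity
    refine (hqQ k _ _ h2).trans (le_of_eq ?_)
    have := (hQ k).ne'
    field_simp
  have hsum : ∀ K, q G ≤ q ((T K).indicator G) +
      ∑ k ∈ Finset.range K, (Q 0 + 1) * (1 / 2) ^ k * B := by
    intro K
    induction K with
    | zero =>
      have : T 0 = Set.univ := Set.eq_univ_of_forall fun z => by simp [hT, hR0]
      simp [this]
    | succ K ih =>
      rw [Finset.sum_range_succ]
      linarith [hstep K]
  have hgeom : ∀ K, ∑ k ∈ Finset.range K, (Q 0 + 1) * (1 / 2) ^ k * B ≤ 2 * (Q 0 + 1) * B := by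
    intro K
    rw [← Finset.sum_mul, ← Finset.mul_sum]
    have h1 : ∑ k ∈ Finset.range K, (1 / 2 : ℝ) ^ k ≤ 2 := by
      have := summable_geometric_two.sum_le_tsum (Finset.range K) (fun _ _ => by positivity)
      rwa [tsum_geometric_two] at this
    have := hQ 0
    calc _ ≤ (Q 0 + 1) * 2 * B := by gcongr
      _ = _ := by ring
  -- the remainder
  obtain ⟨Q', hQ', hq'⟩ := hq (h' / 2) (by positivity)
  -- The tail tends to zero because $G$ decays at some scale $h'$: at scale $h'/2$ its bound is
  -- arbitrarily small far out. Neither $h'$ nor $B'$ enters the final constant.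
  refine le_of_forall_pos_le_add fun ε hε => ?_
  have hδ : 0 < ε / (Q' * (B' + 1)) := by positivity
  obtain ⟨ρ, hρ, hgr⟩ := hM.exists_growth_le_mul hδ
  obtain ⟨K, hK⟩ := (hRt.eventually_ge_atTop (2 * ρ / h')).exists
  have htail : IsSynthesizable M w (h' / 2) (ε / (Q' * (B' + 1)) * B') ((T K).indicator G) := by
    refine ⟨hG'.aesm.indicator (hTm K), fun z => ?_⟩
    by_cases hz : z ∈ T K
    · rw [Set.indicator_of_mem hz]
      have h1 : ρ ≤ h' / 2 * ‖z.2‖ := by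
        have h2 : 2 * ρ / h' ≤ ‖z.2‖ := hK.trans hz
        rw [div_le_iff₀' hh'] at h2
        linarith
      have h3 := hgr _ h1
      rw [show 2 * (h' / 2 * ‖z.2‖) = h' * ‖z.2‖ by ring] at h3
      have h4 := hG'.bound z
      have hGw : 0 ≤ ‖G z‖ * w z.1 := mul_nonneg (norm_nonneg _) (hw _).le
      calc _ ≤ ‖G z‖ * w z.1 * (ε / (Q' * (B' + 1)) * growth M (h' * ‖z.2‖)) := by gcongr
        _ = ε / (Q' * (B' + 1)) * (‖G z‖ * w z.1 * growth M (h' * ‖z.2‖)) := by ring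
        _ ≤ _ := by gcongr
    · rw [Set.indicator_of_notMem hz]
      simp only [norm_zero, zero_mul]
      positivity
  have h1 := hq' _ _ htail
  have h2 : Q' * (ε / (Q' * (B' + 1)) * B') ≤ ε := by
    rw [show Q' * (ε / (Q' * (B' + 1)) * B') = ε * (B' / (B' + 1)) by field_simp]
    refine mul_le_of_le_one_right hε.le ?_
    rw [div_le_one (by positivity)]
    linarith
  linarith [hsum K, hgeom K]

end Shells

/-! ### Algebraic comparison of the two spaces -/

section Membership

variable {d : ℕ} {M : ℕ → ℝ} {w : EuclideanSpace ℝ (Fin d) → ℝ}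
  {φ : EuclideanSpace ℝ (Fin d) → ℂ}

theorem scaledSeq_pos (hM : ∀ n, 0 < M n) {h : ℝ} (hh : 0 < h) (n : ℕ) : 0 < scaledSeq M h n :=
  div_pos (hM n) (pow_pos hh n)

theorem prodSeq_pos (hM : ∀ n, 0 < M n) {r : ℕ → ℝ} (hr : r ∈ KomatsuFamily) (n : ℕ) :
    0 < prodSeq M r n :=
  mul_pos (hM n) (Finset.prod_pos fun j _ => hr.1 j)

theorem scaledSeq_inv (M : ℕ → ℝ) (L : ℝ) (n : ℕ) : scaledSeq M L⁻¹ n = M n * L ^ n := by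
  rw [scaledSeq, inv_pow, div_inv_eq_mul]

theorem norm_iteratedFDeriv_mul_le_of_mem_scaledSeq (hM : ∀ n, 0 < M n) (hw : ∀ x, 0 < w x)
    {h : ℝ} (hh : 0 < h) (hφ : φ ∈ weightedSubmodule (scaledSeq M h) w) (n : ℕ)
    (x : EuclideanSpace ℝ (Fin d)) :
    ‖iteratedFDeriv ℝ n φ x‖ * w x ≤
      (weightedSup (scaledSeq M h) w φ).toReal * (M n * (((d : ℝ) + 1) / h) ^ n) := by
  refine (norm_iteratedFDeriv_mul_le_weightedSup hφ.1 (scaledSeq_pos hM hh) hw hφ.2 n x).trans ?_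
  have hMn := hM n
  rw [scaledSeq, div_pow]
  refine mul_le_mul_of_nonneg_left ?_ ENNReal.toReal_nonneg
  calc (d : ℝ) ^ n * (M n / h ^ n) ≤ ((d : ℝ) + 1) ^ n * (M n / h ^ n) := by gcongr; linarith
    _ = _ := by ring

theorem norm_iteratedFDeriv_mul_le_of_mem_prodSeq (hM : ∀ n, 0 < M n) (hw : ∀ x, 0 < w x)
    {r : ℕ → ℝ} (hr : r ∈ KomatsuFamily) (hφ : φ ∈ weightedSubmodule (prodSeq M r) w) (n : ℕ)
    (x : EuclideanSpace ℝ (Fin d)) :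
    ‖iteratedFDeriv ℝ n φ x‖ * w x ≤ (weightedSup (prodSeq M r) w φ).toReal *
      (((d : ℝ) + 1) ^ n * (M n * ∏ j ∈ Finset.range (n + 1), r j)) := by
  refine (norm_iteratedFDeriv_mul_le_weightedSup hφ.1 (prodSeq_pos hM hr) hw hφ.2 n x).trans ?_
  have := prodSeq_pos hM hr n
  rw [prodSeq] at this ⊢
  gcongr
  linarith

theorem mem_weightedSubmodule_of_bound {N : ℕ → ℝ} (hφ : ContDiff ℝ ∞ φ) (hN : ∀ n, 0 < N n)
    (hw : ∀ x, 0 < w x) {B : ℝ}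
    (h : ∀ n x, ‖iteratedFDeriv ℝ n φ x‖ * w x ≤ B * N n) : φ ∈ weightedSubmodule N w :=
  ⟨hφ, (weightedSup_le_of_iteratedFDeriv hφ hN (fun x => (hw x).le) h).trans_lt
    ENNReal.ofReal_lt_top⟩

theorem mem_weightedSubmodule_scaledSeq_inv (hM : ∀ n, 0 < M n) (hw : ∀ x, 0 < w x)
    (hφ : ContDiff ℝ ∞ φ) {L B : ℝ} (hL : 0 < L)
    (h : ∀ n x, ‖iteratedFDeriv ℝ n φ x‖ * w x ≤ B * (M n * L ^ n)) :
    φ ∈ weightedSubmodule (scaledSeq M L⁻¹) w :=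
  mem_weightedSubmodule_of_bound hφ (scaledSeq_pos hM (inv_pos.2 hL)) hw fun n x => by
    rw [scaledSeq_inv]; exact h n x

theorem weightedSubmodule_scaledSeq_le_prodSeq (hM : ∀ n, 0 < M n) (hw : ∀ x, 0 < w x) {h : ℝ}
    (hh : 0 < h) {r : ℕ → ℝ} (hr : r ∈ KomatsuFamily) :
    ∃ C, 0 < C ∧ ∀ φ ∈ weightedSubmodule (scaledSeq M h) w,
      φ ∈ weightedSubmodule (prodSeq M r) w ∧
      (weightedSup (prodSeq M r) w φ).toReal ≤ C * (weightedSup (scaledSeq M h) w φ).toReal := by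
  obtain ⟨C, hC, hb⟩ := exists_pow_le_mul_prod hr (((d : ℝ) + 1) / h) (by positivity)
  refine ⟨C, hC, fun φ hφ => ?_⟩
  set S := (weightedSup (scaledSeq M h) w φ).toReal with hS
  have hS0 : 0 ≤ S := ENNReal.toReal_nonneg
  have h1 : ∀ n x, ‖iteratedFDeriv ℝ n φ x‖ * w x ≤ C * S * prodSeq M r n := fun n x => by
    refine (norm_iteratedFDeriv_mul_le_of_mem_scaledSeq hM hw hh hφ n x).trans ?_
    have hMn := hM n
    calc S * (M n * (((d : ℝ) + 1) / h) ^ n)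
        ≤ S * (M n * (C * ∏ j ∈ Finset.range (n + 1), r j)) := by gcongr; exact hb n
      _ = _ := by rw [prodSeq]; ring
  refine ⟨mem_weightedSubmodule_of_bound hφ.1 (prodSeq_pos hM hr) hw h1, ?_⟩
  refine ENNReal.toReal_le_of_le_ofReal (by positivity) ?_
  exact weightedSup_le_of_iteratedFDeriv hφ.1 (prodSeq_pos hM hr) (fun x => (hw x).le) h1

/-- For the harder inclusion, a function in no step violates, for each $k$, the bound with constant
$k$ and ratio $(d+1)(k+1)$ at some order $n_k$. A sequence $r$ with $\prod_{j\le n_k}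
r_j\le(k+1)^{n_k}$ then forces its $r$-norm to exceed every $k$. -/
theorem roumieuSubmodule_eq_roumieuProjSubmodule (hM : ∀ n, 0 < M n) (hw : ∀ x, 0 < w x) :
    roumieuSubmodule M w = roumieuProjSubmodule M w := by
  refine le_antisymm ?_ fun φ hφ => ?_
  · rintro φ ⟨h, hh, hφ⟩
    rw [roumieuProjSubmodule, Submodule.mem_iInf]
    intro r
    obtain ⟨C, -, hC⟩ := weightedSubmodule_scaledSeq_le_prodSeq (d := d) hM hw hh r.2
    exact (hC φ hφ).1
  · rw [roumieuProjSubmodule, Submodule.mem_iInf] at hφ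
    have hsm : ContDiff ℝ ∞ φ := (hφ ⟨_, komatsuFamily_nonempty.some_mem⟩).1
    by_contra hcon
    have h1 : ∀ k : ℕ, ∃ n x, (k : ℝ) * (M n * (((d : ℝ) + 1) * ((k : ℝ) + 1)) ^ n) <
        ‖iteratedFDeriv ℝ n φ x‖ * w x := by
      intro k
      by_contra! hk
      exact hcon ⟨_, by positivity, mem_weightedSubmodule_scaledSeq_inv hM hw hsm (by positivity) hk⟩
    choose n x hnx using h1
    obtain ⟨r, hr, hrn⟩ := exists_komatsuFamily_prod_le n
    obtain ⟨k, hk⟩ := exists_nat_gt (weightedSup (prodSeq M r) w φ).toReal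
    have h2 := norm_iteratedFDeriv_mul_le_of_mem_prodSeq hM hw hr (hφ ⟨r, hr⟩) (n k) (x k)
    have h3 := hrn k (n k) le_rfl
    have hMn := hM (n k)
    have hP : 0 < ∏ j ∈ Finset.range (n k + 1), r j := Finset.prod_pos fun j _ => hr.1 j
    refine absurd ((hnx k).trans_le h2) (not_lt.2 ?_)
    calc _ ≤ (k : ℝ) * (((d : ℝ) + 1) ^ n k * (M (n k) * ((k : ℝ) + 1) ^ n k)) := by gcongr
      _ = _ := by rw [mul_pow]; ring

end Membership

/-! ### Windows in Gelfand-Shilov spaces -/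

section Window

variable {d : ℕ} {M A : ℕ → ℝ} {w : EuclideanSpace ℝ (Fin d) → ℝ}

theorem isModerate_of_associatedFun (hA : IsWeightSequence A) (hw_pos : ∀ x, 0 < w x) {C τ : ℝ}
    (hC : 0 < C) (hτ : 0 < τ)
    (hw : ∀ x y, w (x + y) ≤ C * w x * Real.exp (associatedFun A (τ * ‖y‖))) :
    IsModerate w fun y => C * (A 0 * growth A (τ * ‖y‖)) where
  pos := hw_pos
  pos' y := mul_pos hC (mul_pos (hA.1 0) (hA.growth_pos _))
  neg y := by rw [norm_neg]
  bddOn := ⟨C * (A 0 * growth A (τ * 1)), mul_pos hC (mul_pos (hA.1 0) (hA.growth_pos _)),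
    fun y hy => by
      have := hA.1 0
      gcongr
      exact hA.growth_mono (by positivity) (by gcongr)⟩
  le x y := by
    have := hw x y
    rw [hA.exp_associatedFun (by positivity)] at this
    linarith

/-- The Beurling type allows every scale: $h=(d+1)/\kappa$ absorbs the dimensional loss $d^n$, and
the larger dilation $K\tau$ is traded for polynomial decay through $(M.2)'$ for $A_p$. -/
theorem isWindow_of_mem_gelfandShilovBeurling (hM : IsWeightSequence M) (hA : IsWeightSequence A)
    (hA2 : CondM2' A) {C τ : ℝ} (hC : 0 < C) (hτ : 0 < τ) {ψ : EuclideanSpace ℝ (Fin d) → ℂ}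
    (hψ : ψ ∈ gelfandShilovBeurling d M A) :
    IsWindow M (fun y => C * (A 0 * growth A (τ * ‖y‖))) ψ := by
  have hψ' : ∀ h τ : ℝ, 0 < h → 0 < τ → ψ ∈ weightedSubmodule (scaledSeq M h)
      (fun x => Real.exp (associatedFun A (τ * ‖x‖))) := by
    intro h τ hh hτ
    simp only [gelfandShilovBeurling, Submodule.mem_iInf] at hψ
    exact hψ ⟨h, hh⟩ ⟨τ, hτ⟩
  refine ⟨(hψ' 1 1 one_pos one_pos).1, fun κ hκ => ?_⟩
  obtain ⟨K, hK, hg⟩ := hA.exists_one_add_pow_mul_growth_le hA2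
    (Module.finrank ℝ (EuclideanSpace ℝ (Fin d)) + 1)
  obtain ⟨C', hC', hg⟩ := hg τ hτ
  have hh : 0 < ((d : ℝ) + 1) / κ := by positivity
  have hKτ : 0 < K * τ := by positivity
  have hmem := hψ' (((d : ℝ) + 1) / κ) (K * τ) hh hKτ
  set S := (weightedSup (scaledSeq M (((d : ℝ) + 1) / κ))
    (fun x => Real.exp (associatedFun A (K * τ * ‖x‖))) ψ).toReal with hS
  have hS0 : 0 ≤ S := ENNReal.toReal_nonneg
  refine ⟨C * C' * (S + 1), by positivity, fun n s => ?_⟩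
  have h1 := norm_iteratedFDeriv_mul_le_of_mem_scaledSeq hM.1 (fun x => Real.exp_pos _) hh hmem n s
  rw [hA.exp_associatedFun (by positivity), ← hS, div_div_cancel₀ (by positivity)] at h1
  have hMn := hM.1 n
  have hA0 := hA.1 0
  have hd := polyDecay_pos s
  have h2 : growth A (τ * ‖s‖) ≤ C' * growth A (K * τ * ‖s‖) * polyDecay s := by
    rw [polyDecay, ← div_eq_mul_inv, le_div_iff₀ (by positivity), mul_comm]
    exact hg _ (norm_nonneg _)
  calc ‖iteratedFDeriv ℝ n ψ s‖ * (C * (A 0 * growth A (τ * ‖s‖)))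
      ≤ ‖iteratedFDeriv ℝ n ψ s‖ * (C * (A 0 * (C' * growth A (K * τ * ‖s‖) * polyDecay s))) := by
        gcongr
    _ = C * C' * (‖iteratedFDeriv ℝ n ψ s‖ * (A 0 * growth A (K * τ * ‖s‖))) * polyDecay s := by
        ring
    _ ≤ C * C' * ((S + 1) * (M n * κ ^ n)) * polyDecay s := by
        refine mul_le_mul_of_nonneg_right (mul_le_mul_of_nonneg_left ?_ (by positivity)) hd.le
        exact h1.trans (by gcongr; linarith)
    _ = _ := by ring

end Window

/-! ### Continuous seminorms on the inductive limit -/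

section SeminormEstimate

variable {d : ℕ} {M : ℕ → ℝ} {w W : EuclideanSpace ℝ (Fin d) → ℝ}
  {ψ : EuclideanSpace ℝ (Fin d) → ℂ}

/-- The value of a seminorm at the synthesis of a function on phase space, and zero if the synthesis
does not belong to the space. -/
def seminormSynth (ψ : EuclideanSpace ℝ (Fin d) → ℂ) (p : Seminorm ℂ (RoumieuSpace M w))
    (G : EuclideanSpace ℝ (Fin d) × EuclideanSpace ℝ (Fin d) → ℂ) : ℝ :=
  open Classical in
  if h : stftSynth ψ G ∈ roumieuSubmodule M w then p (⟨stftSynth ψ G, h⟩ : roumieuSubmodule M w)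
  -- This default plays no role: the shell argument uses its assumptions on $q$ only at
  -- synthesizable functions.
  else 0

theorem seminormSynth_of_mem {p : Seminorm ℂ (RoumieuSpace M w)}
    {G : EuclideanSpace ℝ (Fin d) × EuclideanSpace ℝ (Fin d) → ℂ}
    (h : stftSynth ψ G ∈ roumieuSubmodule M w) :
    seminormSynth ψ p G = p (⟨stftSynth ψ G, h⟩ : roumieuSubmodule M w) := dif_pos h

/-- The seminorm composed with synthesis is subadditive and bounded on each scale, so the shell
argument provides $r$. Applied to the transform of $\varphi$, whose synthesis is $c\varphi$ with
$c=\|\psi\|_2^2$, it bounds $|c|\,p(\varphi)$ by the $r$-norm. -/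
theorem exists_komatsuFamily_seminorm_le (hM : IsWeightSequence M) (hM1 : CondM1 M)
    (hM2 : CondM2' M) (hw : IsModerate w W) (hψ : IsWindow M W ψ) (hψ0 : ψ ≠ 0)
    (p : Seminorm ℂ (RoumieuSpace M w))
    (hp : ∀ h : {h : ℝ // 0 < h}, ∃ C, 0 < C ∧ ∀ f : WeightedSpace (scaledSeq M h) w,
      p (RoumieuSpace.ofStep M w h f) ≤ C * (weightedSup (scaledSeq M h) w f.1).toReal) :
    ∃ r ∈ KomatsuFamily, ∃ C, 0 < C ∧ ∀ φ : RoumieuSpace M w,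
      φ.1 ∈ weightedSubmodule (prodSeq M r) w →
      p φ ≤ C * (weightedSup (prodSeq M r) w φ.1).toReal := by
  have hp' : ∀ L : ℝ, 0 < L → ∃ C, 0 < C ∧ ∀ (φ : RoumieuSpace M w) (B : ℝ), 0 ≤ B →
      ContDiff ℝ ∞ φ.1 → (∀ n x, ‖iteratedFDeriv ℝ n φ.1 x‖ * w x ≤ B * (M n * L ^ n)) →
      p φ ≤ C * B := by
    intro L hL
    obtain ⟨C, hC, h⟩ := hp ⟨L⁻¹, inv_pos.2 hL⟩
    refine ⟨C, hC, fun φ B hB hφ hb => ?_⟩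
    have hmem := mem_weightedSubmodule_scaledSeq_inv hM.1 hw.pos hφ hL hb
    refine (h ⟨φ.1, hmem⟩).trans ?_
    gcongr
    refine ENNReal.toReal_le_of_le_ofReal hB ?_
    refine weightedSup_le_of_iteratedFDeriv hφ (scaledSeq_pos hM.1 (inv_pos.2 hL))
      (fun x => (hw.pos x).le) fun n x => ?_
    rw [scaledSeq_inv]
    exact hb n x
  have hmem : ∀ h, 0 < h → ∀ G B, IsSynthesizable M w h B G →
      stftSynth ψ G ∈ roumieuSubmodule M w := by
    intro h hh G B hG
    obtain ⟨C, L, hC, hL, hs⟩ := hψ.exists_stftSynth hw hM hM1 hM2 hh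
    obtain ⟨-, h1, h2⟩ := hs G B hG
    exact ⟨L⁻¹, inv_pos.2 hL, mem_weightedSubmodule_scaledSeq_inv hM.1 hw.pos h1 hL h2⟩
  have hBnn : ∀ h G B, IsSynthesizable M w h B G → 0 ≤ B := fun h G B hG => by
    refine le_trans ?_ (hG.bound 0)
    exact mul_nonneg (mul_nonneg (norm_nonneg _) (hw.pos _).le) (hM.growth_pos _).le
  obtain ⟨r, hr, C, hC, hcore⟩ := exists_komatsuFamily_le hM hw.pos
    (by positivity : (0 : ℝ) < (d : ℝ) + 1) (seminormSynth ψ p)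
    (fun h hh => by
      obtain ⟨C, L, hC, hL, hs⟩ := hψ.exists_stftSynth hw hM hM1 hM2 hh
      obtain ⟨C', hC', hpL⟩ := hp' L hL
      refine ⟨C' * C, by positivity, fun G B hG => ?_⟩
      obtain ⟨-, h1, h2⟩ := hs G B hG
      rw [seminormSynth_of_mem (hmem h hh G B hG), mul_assoc]
      have hB := hBnn h G B hG
      exact hpL _ _ (by positivity) h1 h2)
    (fun h B G S hh hG hS => by
      have hB := hBnn h G B hG
      have hG1 := hG.indicator hB hS
      have hG2 := hG.indicator hB hS.compl
      obtain ⟨C, L, hC, hL, hs⟩ := hψ.exists_stftSynth hw hM hM1 hM2 hh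
      rw [seminormSynth_of_mem (hmem h hh _ _ hG), seminormSynth_of_mem (hmem h hh _ _ hG1),
        seminormSynth_of_mem (hmem h hh _ _ hG2)]
      have hadd : stftSynth ψ G = stftSynth ψ (S.indicator G) + stftSynth ψ (Sᶜ.indicator G) := by
        funext t
        rw [Pi.add_apply, stftSynth, stftSynth, stftSynth,
          ← integral_add ((hs _ _ hG1).1 t) ((hs _ _ hG2).1 t)]
        refine integral_congr_ae (Eventually.of_forall fun z => ?_)
        simp only
        rw [← add_mul, ← Pi.add_apply, Set.indicator_self_add_compl]
      have heq : (⟨stftSynth ψ G, hmem h hh _ _ hG⟩ : roumieuSubmodule M w) =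
          (⟨stftSynth ψ (S.indicator G), hmem h hh _ _ hG1⟩ : roumieuSubmodule M w) +
          (⟨stftSynth ψ (Sᶜ.indicator G), hmem h hh _ _ hG2⟩ : roumieuSubmodule M w) :=
        Subtype.ext hadd
      rw [heq]
      exact map_add_le_add p _ _)
  -- Compatibility of $N_n=(d+1)^nM_n\prod_{i\le n} r_i$ with $M$: as $r$ is nondecreasing, $m$
  -- further factors contribute at least $r_0^m$, whence $l=((d+1)r_0)^{-1}$.
  have hMr : ∀ j m, ((d : ℝ) + 1) ^ j * (M j * ∏ i ∈ Finset.range (j + 1), r i) * M m ≤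
      M 0 * ((((d : ℝ) + 1) * r 0)⁻¹) ^ m *
        (((d : ℝ) + 1) ^ (j + m) * (M (j + m) * ∏ i ∈ Finset.range (j + m + 1), r i)) := by
    intro j m
    have hr0 := hr.1 0
    have hP : ∀ n, 0 < ∏ i ∈ Finset.range (n + 1), r i := fun n =>
      Finset.prod_pos fun i _ => hr.1 i
    have h1 : (∏ i ∈ Finset.range (j + 1), r i) * r 0 ^ m ≤
        ∏ i ∈ Finset.range (j + m + 1), r i := by
      induction m with
      | zero => simp
      | succ m ih =>
        rw [show j + (m + 1) + 1 = (j + m + 1) + 1 by ring, Finset.prod_range_succ _ (j + m + 1), pow_succ,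
          ← mul_assoc]
        exact mul_le_mul ih (hr.2.1 (Nat.zero_le (j + m + 1))) hr0.le (hP _).le
    have h2 := hM.mul_le_of_condM1 hM1 j m
    have h3 := hP j
    have hM0 := hM.1 0
    have hMjm := hM.1 (j + m)
    have hD : (0 : ℝ) < (d : ℝ) + 1 := by positivity
    calc ((d : ℝ) + 1) ^ j * (M j * ∏ i ∈ Finset.range (j + 1), r i) * M m
        = ((d : ℝ) + 1) ^ j * (∏ i ∈ Finset.range (j + 1), r i) * (M j * M m) := by ring
      _ ≤ ((d : ℝ) + 1) ^ j * (∏ i ∈ Finset.range (j + 1), r i) * (M 0 * M (j + m)) := by gcongr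
      _ = M 0 * ((((d : ℝ) + 1) * r 0)⁻¹) ^ m * (((d : ℝ) + 1) ^ (j + m) * (M (j + m) *
          ((∏ i ∈ Finset.range (j + 1), r i) * r 0 ^ m))) := by
        rw [inv_pow, mul_pow, pow_add]
        field_simp
      _ ≤ _ := by gcongr
  obtain ⟨C₁, hC₁, hstft⟩ := hψ.exists_stft_le hw hM.1 (hM.1 0)
    (inv_pos.2 (mul_pos (by positivity : (0 : ℝ) < (d : ℝ) + 1) (hr.1 0)))
  set c := ∫ s, (starRingEnd ℂ) (ψ s) * ψ s with hc
  have hc0 : c ≠ 0 := hψ.integral_ne_zero hw.one_le hψ0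
  have hcn : 0 < ‖c‖ := norm_pos_iff.2 hc0
  refine ⟨r, hr, C * C₁ / ‖c‖, by positivity, fun φ hφ => ?_⟩
  set S := (weightedSup (prodSeq M r) w φ.1).toReal with hS
  have hS0 : 0 ≤ S := ENNReal.toReal_nonneg
  -- The step containing $\varphi$ is used only qualitatively, for convergence of the integrals and
  -- of the tail.
  obtain ⟨h, hh, hφh⟩ := φ.2
  have hL : 0 < ((d : ℝ) + 1) / h := by positivity
  obtain ⟨C₂, hC₂, hsyn⟩ := hψ.exists_isSynthesizable_stft hw hM hM1 hL
  have hG := hsyn φ.1 _ hφ.1 ENNReal.toReal_nonneg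
    (norm_iteratedFDeriv_mul_le_of_mem_scaledSeq hM.1 hw.pos hh hφh)
  have hh' : 0 < Real.pi / (((d : ℝ) + 1) / h) := by positivity
  have h1 := hcore (stft ψ φ.1) (C₁ * S) ⟨_, _, hh', hG⟩ (hstft _ φ.1 S hφ.1 hS0
    (norm_iteratedFDeriv_mul_le_of_mem_prodSeq hM.1 hw.pos hr hφ) hMr)
  have hmemG := hmem _ hh' _ _ hG
  rw [seminormSynth_of_mem hmemG] at h1
  obtain ⟨_, _, _, _, hs⟩ := hψ.exists_stftSynth hw hM hM1 hM2 hh'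
  have hrec : stftSynth ψ (stft ψ φ.1) = c • φ.1 := by
    funext t
    refine stftSynth_stft hψ.contDiff hφ.1 (fun x => ?_) (fun x => ?_) t ((hs _ _ hG).1 t)
    · obtain ⟨C₃, -, hb⟩ := hψ.exists_norm_iteratedFDeriv_mul_le hw hM.1 (hM.1 0)
        (inv_pos.2 (mul_pos (by positivity : (0 : ℝ) < (d : ℝ) + 1) (hr.1 0)))
      have hb := hb _ φ.1 S hφ.1 hS0
        (norm_iteratedFDeriv_mul_le_of_mem_prodSeq hM.1 hw.pos hr hφ) hMr 0 x
      simp only [norm_iteratedFDeriv_zero] at hb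
      exact integrable_of_norm_mul_le (contDiff_windowed hψ.contDiff hφ.1 x).continuous
        (hw.pos x) x hb
    · obtain ⟨c', hc'⟩ := hG.exists_norm_le hw.pos hM hM2 hh' x
      exact (integrable_polyDecay.const_mul c').mono'
        ((stronglyMeasurable_stft hψ.contDiff.continuous hφ.1.continuous).comp_measurable
          measurable_prodMk_left).aestronglyMeasurable (Eventually.of_forall hc')
  have heq : (⟨stftSynth ψ (stft ψ φ.1), hmemG⟩ : roumieuSubmodule M w) =
      (c • φ : RoumieuSpace M w) := Subtype.ext hrec
  rw [heq, map_smul_eq_mul] at h1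
  rw [div_mul_eq_mul_div, le_div_iff₀ hcn]
  linarith

end SeminormEstimate

/-! ### Topological comparison of the two spaces -/

section Topological

variable {d : ℕ}

instance (N : ℕ → ℝ) (v : EuclideanSpace ℝ (Fin d) → ℝ) : Module ℂ (WeightedSpace N v) :=
  inferInstanceAs (Module ℂ (weightedSubmodule N v))

theorem WeightedSpace.norm_eq {N : ℕ → ℝ} {v : EuclideanSpace ℝ (Fin d) → ℝ}
    (f : WeightedSpace N v) : ‖f‖ = (weightedSup N v f.1).toReal := rfl

instance (N : ℕ → ℝ) (v : EuclideanSpace ℝ (Fin d) → ℝ) : NormedSpace ℂ (WeightedSpace N v) where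
  norm_smul_le c f := (map_smul_eq_mul (weightedSeminorm N v) c f).le

variable (M : ℕ → ℝ) (w : EuclideanSpace ℝ (Fin d) → ℝ)

/-- The inclusion of a step as a linear map. -/
def RoumieuSpace.ofStepₗ (h : {h : ℝ // 0 < h}) :
    WeightedSpace (scaledSeq M h) w →ₗ[ℂ] RoumieuSpace M w where
  toFun := RoumieuSpace.ofStep M w h
  map_add' _ _ := rfl
  map_smul' _ _ := rfl

theorem withSeminorms_roumieuProjSeminorms : WithSeminorms (roumieuProjSeminorms M w) := ⟨rfl⟩

theorem roumieuProjSeminorms_apply (r : KomatsuFamily) (φ : RoumieuProjSpace M w) :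
    roumieuProjSeminorms M w r φ = (weightedSup (prodSeq M r) w φ.1).toReal := rfl

/-- A linear map into a locally convex space is continuous if every continuous seminorm of the target
is dominated on its range by a seminorm of the source. -/
theorem WithSeminorms.continuous_of_seminorm_le {P E ι : Type*} [Nonempty ι] [AddCommGroup P]
    [Module ℂ P] [TopologicalSpace P] {p : SeminormFamily ℂ P ι} (hp : WithSeminorms p)
    [AddCommGroup E] [Module ℂ E] [Module ℝ E] [IsScalarTower ℝ ℂ E] [TopologicalSpace E]
    [IsTopologicalAddGroup E] [ContinuousSMul ℂ E] [LocallyConvexSpace ℝ E] (f : P →ₗ[ℂ] E)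
    (h : ∀ q : Seminorm ℂ E, Continuous q → ∃ i C, ∀ x, q (f x) ≤ C * p i x) : Continuous f := by
  open scoped ComplexOrder in
  have : LocallyConvexSpace ℂ E := ⟨fun x => by
    simpa only [convex_RCLike_iff_convex_real] using LocallyConvexSpace.convex_basis (𝕜 := ℝ) x⟩
  have : ContinuousSMul ℝ E := IsScalarTower.continuousSMul ℂ
  have hE := PolynormableSpace.withSeminorms ℂ E
  refine WithSeminorms.continuous_of_isBounded hp hE f fun q => ?_
  obtain ⟨i, C, hC⟩ := h q.1 q.2
  refine ⟨{i}, C.toNNReal, fun x => ?_⟩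
  simp only [Finset.sup_singleton, Seminorm.comp_apply, smul_apply, NNReal.smul_def,
    smul_eq_mul]
  exact (hC x).trans (mul_le_mul_of_nonneg_right (Real.le_coe_toNNReal C) (apply_nonneg _ _))

theorem WithSeminorms.isLocallyConvexTVS_induced {P E ι : Type*} [Nonempty ι] [AddCommGroup P]
    [Module ℂ P] [TopologicalSpace P] {p : SeminormFamily ℂ P ι} (hp : WithSeminorms p)
    [AddCommGroup E] [Module ℂ E] [Module ℝ E] [IsScalarTower ℝ ℂ E] (f : E →ₗ[ℂ] P) :
    @IsTopologicalAddGroup E (TopologicalSpace.induced f inferInstance) _ ∧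
      @ContinuousSMul ℂ E _ _ (TopologicalSpace.induced f inferInstance) ∧
      @LocallyConvexSpace ℝ E _ _ _ _ (TopologicalSpace.induced f inferInstance) := by
  let _ : TopologicalSpace E := TopologicalSpace.induced f inferInstance
  have hi : WithSeminorms (p.comp f) := LinearMap.withSeminorms_induced hp f
  exact ⟨hi.topologicalAddGroup, hi.continuousSMul, hi.toLocallyConvexSpace⟩

variable {M w}

/-- The linear isomorphism between the two spaces. -/
def roumieuEquiv (h : roumieuSubmodule M w = roumieuProjSubmodule M w) :
    RoumieuSpace M w ≃ₗ[ℂ] RoumieuProjSpace M w :=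
  LinearEquiv.ofEq (roumieuSubmodule M w) (roumieuProjSubmodule M w) h

instance : IsScalarTower ℝ ℂ (RoumieuSpace M w) := IsScalarTower.restrictScalars ℝ ℂ _

theorem continuous_roumieuEquiv_ofStep (hM : ∀ n, 0 < M n) (hw : ∀ x, 0 < w x)
    (h : roumieuSubmodule M w = roumieuProjSubmodule M w) (k : {k : ℝ // 0 < k}) :
    Continuous ((roumieuEquiv h).toLinearMap ∘ₗ RoumieuSpace.ofStepₗ M w k) := by
  refine WithSeminorms.continuous_of_isBounded (norm_withSeminorms ℂ _)
    (withSeminorms_roumieuProjSeminorms M w) _ fun r => ?_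
  obtain ⟨C, hC, hb⟩ := weightedSubmodule_scaledSeq_le_prodSeq (d := d) hM hw k.2 r.2
  refine ⟨{0}, C.toNNReal, fun f => ?_⟩
  simp only [Finset.sup_singleton, Seminorm.comp_apply, smul_apply, NNReal.smul_def,
    smul_eq_mul, Real.coe_toNNReal C hC.le, coe_normSeminorm]
  rw [WeightedSpace.norm_eq, roumieuProjSeminorms_apply]
  exact (hb f.1 f.2).2

/-- The topology pulled back from the projective space is locally convex and makes all the
inclusions of steps continuous, so the inductive limit topology is finer. -/
theorem continuous_roumieuEquiv (hM : ∀ n, 0 < M n) (hw : ∀ x, 0 < w x)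
    (h : roumieuSubmodule M w = roumieuProjSubmodule M w) : Continuous (roumieuEquiv h) := by
  have hi := (withSeminorms_roumieuProjSeminorms M w).isLocallyConvexTVS_induced
      (roumieuEquiv h).toLinearMap
  exact continuous_iff_le_induced.2
    (sInf_le ⟨fun k => continuous_induced_rng.2 (continuous_roumieuEquiv_ofStep hM hw h k), hi⟩)

theorem continuous_roumieuEquiv_symm {W : EuclideanSpace ℝ (Fin d) → ℝ}
    {ψ : EuclideanSpace ℝ (Fin d) → ℂ} (hM : IsWeightSequence M) (hM1 : CondM1 M)
    (hM2 : CondM2' M) (hw : IsModerate w W) (hψ : IsWindow M W ψ) (hψ0 : ψ ≠ 0)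
    (h : roumieuSubmodule M w = roumieuProjSubmodule M w) :
    Continuous (roumieuEquiv h).symm := by
  -- Continuity is tested against each admissible topology $t$ separately, so it need not be known
  -- that the infimum is itself admissible. A $t$-continuous seminorm is bounded on every step.
  refine continuous_sInf_rng.2 ?_
  rintro t ⟨ht, ht1, ht2, ht3⟩
  refine @WithSeminorms.continuous_of_seminorm_le _ _ _ _ _ _ _ _
    (withSeminorms_roumieuProjSeminorms M w) _ _ _ _ t ht1 ht2 ht3
    (roumieuEquiv h).symm.toLinearMap fun q hq => ?_
  obtain ⟨r, hr, C, -, hC⟩ := exists_komatsuFamily_seminorm_le hM hM1 hM2 hw hψ hψ0 q fun k =>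
    Seminorm.bound_of_continuous_normedSpace (q.comp (RoumieuSpace.ofStepₗ M w k))
      (@Continuous.comp _ _ _ _ t _ _ _ hq (ht k))
  refine ⟨⟨r, hr⟩, C, fun φ => ?_⟩
  exact hC _ ((iInf_le (fun r : KomatsuFamily => weightedSubmodule (prodSeq M r) w) ⟨r, hr⟩) φ.2)

end Topological

end

theorem mainTheorem2 (d : ℕ) (M A : ℕ → ℝ)
    (hM : IsWeightSequence M) (hM1 : CondM1 M) (hM2 : CondM2' M)
    (hA : IsWeightSequence A) (hA1 : CondM1 A) (hA2 : CondM2' A)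
    (hS : gelfandShilovBeurling d M A ≠ ⊥)
    (w : EuclideanSpace ℝ (Fin d) → ℝ) (hw_pos : ∀ x, 0 < w x)
    (hw_meas : AEMeasurable w volume)
    (hw : ∃ C τ : ℝ, 0 < C ∧ 0 < τ ∧
      ∀ x y, w (x + y) ≤ C * w x * Real.exp (associatedFun A (τ * ‖y‖))) :
    ∃ e : RoumieuSpace M w ≃L[ℂ] RoumieuProjSpace M w,
      ∀ φ : RoumieuSpace M w,
        (e φ : EuclideanSpace ℝ (Fin d) → ℂ) = (φ : EuclideanSpace ℝ (Fin d) → ℂ) := by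
  obtain ⟨C, τ, hC, hτ, hw⟩ := hw
  obtain ⟨ψ, hψ, hψ0⟩ := Submodule.exists_mem_ne_zero_of_ne_bot hS
  have h := roumieuSubmodule_eq_roumieuProjSubmodule (w := w) hM.1 hw_pos
  exact ⟨⟨roumieuEquiv h, continuous_roumieuEquiv hM.1 hw_pos h,
    continuous_roumieuEquiv_symm hM hM1 hM2 (isModerate_of_associatedFun hA hw_pos hC hτ hw)
      (isWindow_of_mem_gelfandShilovBeurling hM hA hA2 hC hτ hψ) hψ0 h⟩, fun _ => rfl⟩
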